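/- **Setting.** Let $\mathcal G=(\mathcal V,\mathcal E)$ be a connected graph with $n$ nodes, $m$ edges and incidence matrix $B$ (ends of edges labelled arbitrarily), and let $\mathcal G_c=(\mathcal V,\mathcal E_c)$ be a (not necessarily connected) graph with incidence matrix $B_c$. Let $\mathcal V_e\subseteq\mathcal V$, $|\mathcal V_e|=p\ge 1$, be the nodes with a controllable input and $\mathcal V_c\subseteq\mathcal V$ the nodes with a state dependent in- /outflow; $E$ and $E_c$ are the 0-1 matrices whose columns are the unit vectors of the nodes in $\mathcal V_e$ and $\mathcal V_c$. Consider the closed loop system $$\begin{aligned}T_x\dot x&=\Psi(x)-Bf(\mu)+Eg(\theta)-d,\qquad T_\mu\dot\mu=B^T(h(x)-\overline y),\\ T_\theta\dot\theta&=-E^T(h(x)-\overline y)-(g(\theta)-\phi),\qquad T_\phi\dot\phi=g(\theta)-\phi-QL^{com}(Q\phi+r),\end{aligned}$$ with $\Psi(x)=-B_c\gamma(B_c^Th(x))-E_c\eta(E_c^Th(x))$, flows $\lambda=f(\mu)$ and inputs $u=g(\theta)$. Here $T_x,T_\mu,T_\theta,T_\phi$ and $Q=\mathrm{diag}(q_i)$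 are diagonal with positive entries, $d$, $\overline y$, $r$ are constant vectors, and all nonlinear maps act componentwise and are continuously differentiable; the $h_i,f_k,g_i$ are strictly increasing and the $\gamma_k,\eta_i$ nondecreasing. The ranges of $f_k$ and $g_i$ are the open intervals $(\lambda_k^-,\lambda_k^+)$ and $(u_i^-,u_i^+)$ (infinite bounds allowed). $L^{com}$ is the Laplacian of a directed graph on $\mathcal V_e$ with nonnegative weights which is balanced and strongly connected. Assume $\overline y_i$ is in the range of $h_i$ for all $i\in\mathcal V$ and let $\overline x$ be the point with $h(\overline x)=\overline y$. Put $$\hat u=Q^{-1}(\hat\kappa-r),\quad \hat\kappa=E^T\frac{\mathbb 1_n\mathbb 1_n^T}{\mathbb 1_p^TQ^{-1}\mathbb 1_p}\big(\hat d+EQ^{-1}r\big),\quad \hat d=d+E_c\eta(E_c^Th(\overline x)),$$ and assume that $\hat u_i$ is in the range of $g_i$ for all $i\in\mathcal V_e$ and that for some $\omega\in\mathbb R^m$ every entry $[B^\dagger(\Psi(\overline x)+E\hat u-d)+(I-B^\dagger B)\omega]_k$ is in the range of $f_k$, where $B^\dagger$ is the Moore-Penrose pseudoinverse. A set $\mathcal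 V_0\subseteq\mathcal V$ is a *zero forcing set* for $\mathcal G$ if, starting from the nodes of $\mathcal V_0$ coloured black and the others white, all nodes become black under repeated application of the rule: if a black node has exactly one white neighbour, that neighbour becomes black. **Corollary (Combined modifications).** Let $\mathcal V_s=\{i\in\mathcal V_c:\ \eta_i'([E_c^Th(\overline x)]_i)>0\}$ and suppose that $\mathcal V_e\cup\mathcal V_s$ is a zero forcing set for $\mathcal G$. Then: 1. $\hat u$ is the unique $u$ that solves: minimize $C(u)=\sum_{i\in\mathcal V_e}(\tfrac12q_iu_i^2+r_iu_i+s_i)$ over $(u,\lambda)$ subject to $0=\Psi(\overline x)-B\lambda+Eu-d$. 2. The closed loop system has a steady state, and from every initial condition there is a solution on $[0,\infty)$. Every steady state $(\overline x',\overline\mu,\overline\theta,\overline\phi)$ has $\overline x'=\overline x$. 3. For every steady state $(\overline x,\overline\mu,\overline\theta,\overline\phi)$, every solution on $[0,\infty)$ converges, as $t\to\infty$, to a point of $$\Upsilon_4=\{(x,\mu,\theta,\phi):\ B(f(\mu)-f(\overline\mu))=0,\ x=\overline x,\ \theta=\overline\theta,\ \phi=\overline\phi\},$$ and all points of $\Upsilon_4$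 are steady states (so that $\lambda=f(\mu)$ is constant there) with $h(x)=\overline y$ and $u=g(\theta)=\hat u$. 4. Hence every solution satisfies $\|h(x(t))-\overline y\|\to0$ and $\|u(t)-\hat u\|\to0$; moreover $\lambda_k^-<\lambda_k(t)<\lambda_k^+$ and $u_i^-<u_i(t)<u_i^+$ for all $k\in\mathcal E$, $i\in\mathcal V_e$ and $t\ge0$. -/

import Mathlib

open Filter Topology Set

/-- A finite undirected graph without self-loops, with edges indexed by `ι`, each edge having its
ends arbitrarily labelled as positive and negative. (Parallel edges are not excluded.) -/
structure OrientedGraph (V ι : Type*) where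
  pos : ι → V
  neg : ι → V
  ne : ∀ k, pos k ≠ neg k

namespace OrientedGraph

/-- The underlying undirected graph: two nodes are adjacent if some edge joins them. -/
def graph {V ι : Type*} (G : OrientedGraph V ι) : SimpleGraph V where
  Adj i j := ∃ k, (G.pos k = i ∧ G.neg k = j) ∨ (G.pos k = j ∧ G.neg k = i)
  symm := ⟨fun _ _ ⟨k, hk⟩ => ⟨k, hk.symm⟩⟩
  loopless := ⟨fun _ ⟨k, hk⟩ => by
    rcases hk with ⟨h1, h2⟩ | ⟨h1, h2⟩ <;> exact G.ne k (h1.trans h2.symm)⟩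

/-- The incidence matrix. -/
def incidence {V ι : Type*} [DecidableEq V] (G : OrientedGraph V ι) : Matrix V ι ℝ :=
  Matrix.of fun i k => if i = G.pos k then 1 else if i = G.neg k then -1 else 0

end OrientedGraph

/-- The nodes that are black when the graph coloring rule has been applied, starting from the black
nodes `S`, until no more changes are possible: if `i` is black and all its neighbours other than the
neighbour `j` are black, then `j` becomes black. -/
inductive Forced {V : Type*} (G : SimpleGraph V) (S : Set V) : V → Prop
  | init (i : V) : i ∈ S → Forced G S i
  | step (i j : V) : Forced G S i → G.Adj i j →
      (∀ k, G.Adj i k → k ≠ j → Forced G S k) → Forced G S j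

/-- `S` is a zero forcing set for `G`. -/
def IsZeroForcingSet {V : Type*} (G : SimpleGraph V) (S : Set V) : Prop :=
  ∀ i, Forced G S i

/-- `P` is the Moore-Penrose pseudoinverse of the real matrix `A` (the four Penrose equations). -/
def IsMoorePenrose {V ι : Type*} [Fintype V] [Fintype ι] (A : Matrix V ι ℝ) (P : Matrix ι V ℝ) :
    Prop :=
  A * P * A = A ∧ P * A * P = P ∧ (A * P).transpose = A * P ∧ (P * A).transpose = P * A

/-- The 0-1 matrix whose columns are the unit vectors of the nodes in `S`. -/
def selection {V : Type*} [DecidableEq V] (S : Finset V) : Matrix V S ℝ :=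
  Matrix.of fun i j => if i = j.1 then 1 else 0

/-- Componentwise application of scalar functions. -/
def mapVec {α : Type*} (F : α → ℝ → ℝ) (v : α → ℝ) : α → ℝ := fun i => F i (v i)

/-- The data of a compartmental flow network and of its controllers. Nodes: `V`; edges of the flow
network: `ι`; edges of the compartmental interconnection: `κ`. -/
structure FlowSystem (V ι κ : Type*) where
  /-- the graph of the network -/
  net : OrientedGraph V ι
  /-- the graph of the compartmental interconnection -/
  comp : OrientedGraph V κ
  /-- nodes with a controllable external input -/
  Ve : Finset V
  /-- nodes with a state dependent inflow/outflow -/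
  Vc : Finset V
  Tx : V → ℝ
  Tmu : ι → ℝ
  Tth : Ve → ℝ
  Tph : Ve → ℝ
  /-- output functions of the nodes -/
  h : V → ℝ → ℝ
  /-- output functions of the flow dynamics -/
  f : ι → ℝ → ℝ
  /-- output functions of the node controllers -/
  g : Ve → ℝ → ℝ
  /-- flows between compartments -/
  gam : κ → ℝ → ℝ
  /-- state dependent outflows -/
  eta : Vc → ℝ → ℝ
  /-- disturbance -/
  d : V → ℝ
  /-- setpoint -/
  ybar : V → ℝ
  /-- cost coefficients -/
  q : Ve → ℝ
  r : Ve → ℝ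
  s : Ve → ℝ
  /-- weights of the directed communication graph -/
  w : Ve → Ve → ℝ
  /-- bounds on the flows and the inputs, possibly infinite -/
  lamMin : ι → EReal
  lamMax : ι → EReal
  uMin : Ve → EReal
  uMax : Ve → EReal

namespace FlowSystem

variable {V ι κ : Type*} [Fintype V] [Fintype ι] [Fintype κ] [DecidableEq V]

/-- Incidence matrix of the network. -/
def B (S : FlowSystem V ι κ) : Matrix V ι ℝ := S.net.incidence

/-- Incidence matrix of the compartmental interconnection. -/
def Bc (S : FlowSystem V ι κ) : Matrix V κ ℝ := S.comp.incidence

/-- Location of the controllable external inputs. -/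
def E (S : FlowSystem V ι κ) : Matrix V S.Ve ℝ := selection S.Ve

/-- Location of the state dependent inflows/outflows. -/
def Ec (S : FlowSystem V ι κ) : Matrix V S.Vc ℝ := selection S.Vc

/-- Matrix of the quadratic costs. -/
def Q (S : FlowSystem V ι κ) : Matrix S.Ve S.Ve ℝ := Matrix.diagonal S.q

/-- Laplacian matrix of the communication graph. -/
def Lcom (S : FlowSystem V ι κ) : Matrix S.Ve S.Ve ℝ :=
  Matrix.diagonal (fun i => ∑ j, S.w i j) - Matrix.of S.w

/-- `Ψ(x) = -B_c γ(B_cᵀ h(x)) - E_c η(E_cᵀ h(x))`. -/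
def Psi (S : FlowSystem V ι κ) (x : V → ℝ) : V → ℝ :=
  -(S.Bc.mulVec (mapVec S.gam (S.Bc.transpose.mulVec (mapVec S.h x))))
    - S.Ec.mulVec (mapVec S.eta (S.Ec.transpose.mulVec (mapVec S.h x)))

/-- The states `(x, μ, θ, φ)` of the closed loop system. -/
abbrev State (S : FlowSystem V ι κ) : Type _ := (V → ℝ) × (ι → ℝ) × (S.Ve → ℝ) × (S.Ve → ℝ)

/-- The vector field of the closed loop system
`T_x x' = Ψ(x) - B f(μ) + E g(θ) - d`, `T_μ μ' = Bᵀ (h(x) - ȳ)`,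
`T_θ θ' = -Eᵀ (h(x) - ȳ) - (g(θ) - φ)`, `T_φ φ' = g(θ) - φ - Q L (Q φ + r)`. -/
noncomputable def field (S : FlowSystem V ι κ) : S.State → S.State := fun ⟨x, mu, th, ph⟩ =>
  ( fun i => (S.Psi x - S.B.mulVec (mapVec S.f mu) + S.E.mulVec (mapVec S.g th) - S.d) i / S.Tx i,
    fun k => S.B.transpose.mulVec (mapVec S.h x - S.ybar) k / S.Tmu k,
    fun i => (-S.E.transpose.mulVec (mapVec S.h x - S.ybar) - (mapVec S.g th - ph)) i / S.Tth i,
    fun i => (mapVec S.g th - ph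
      - S.Q.mulVec (S.Lcom.mulVec (S.Q.mulVec ph + S.r))) i / S.Tph i )

/-- `z` is a solution of the closed loop system on `[0, ∞)`. -/
def IsSolution (S : FlowSystem V ι κ) (z : ℝ → S.State) : Prop :=
  ∀ t, 0 ≤ t → HasDerivWithinAt z (S.field (z t)) (Ici 0) t

/-- `z` is a steady state of the closed loop system. -/
def IsEquilibrium (S : FlowSystem V ι κ) (z : S.State) : Prop := S.field z = 0

/-- Positive gains, regular and monotone scalar functions, strictly convex costs. -/
structure Regular (S : FlowSystem V ι κ) : Prop where
  Tx_pos : ∀ i, 0 < S.Tx i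
  Tmu_pos : ∀ k, 0 < S.Tmu k
  Tth_pos : ∀ i, 0 < S.Tth i
  Tph_pos : ∀ i, 0 < S.Tph i
  q_pos : ∀ i, 0 < S.q i
  h_contDiff : ∀ i, ContDiff ℝ 1 (S.h i)
  h_strictMono : ∀ i, StrictMono (S.h i)
  gam_contDiff : ∀ k, ContDiff ℝ 1 (S.gam k)
  gam_mono : ∀ k, Monotone (S.gam k)
  eta_contDiff : ∀ i, ContDiff ℝ 1 (S.eta i)
  eta_mono : ∀ i, Monotone (S.eta i)

/-- The communication graph has nonnegative weights, is balanced and strongly connected. -/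
structure GoodCommunication (S : FlowSystem V ι κ) : Prop where
  nonneg : ∀ i j, 0 ≤ S.w i j
  balanced : ∀ i, ∑ j, S.w i j = ∑ j, S.w j i
  strongly_connected : ∀ i j, Relation.ReflTransGen (fun a b => 0 < S.w a b) i j

/-- The functions `f_k`, `g_i` are continuously differentiable and strictly increasing, with range
equal to the open interval of admissible flows, respectively inputs. -/
structure GoodOutputs (S : FlowSystem V ι κ) : Prop where
  f_contDiff : ∀ k, ContDiff ℝ 1 (S.f k)
  f_strictMono : ∀ k, StrictMono (S.f k)
  f_range : ∀ k, range (S.f k) = {y : ℝ | S.lamMin k < (y : EReal) ∧ (y : EReal) < S.lamMax k}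
  g_contDiff : ∀ i, ContDiff ℝ 1 (S.g i)
  g_strictMono : ∀ i, StrictMono (S.g i)
  g_range : ∀ i, range (S.g i) = {y : ℝ | S.uMin i < (y : EReal) ∧ (y : EReal) < S.uMax i}

/-- `C(u) = ∑ᵢ (½ qᵢ uᵢ² + rᵢ uᵢ + sᵢ)`. -/
noncomputable def cost (S : FlowSystem V ι κ) (u : S.Ve → ℝ) : ℝ :=
  ∑ i, (1 / 2 * S.q i * u i ^ 2 + S.r i * u i + S.s i)

/-- The constraint `0 = Ψ(x̄) - B λ + E u - d`. -/
def Feasible (S : FlowSystem V ι κ) (xbar : V → ℝ) (u : S.Ve → ℝ) (lam : ι → ℝ) : Prop :=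
  0 = S.Psi xbar - S.B.mulVec lam + S.E.mulVec u - S.d

/-- `u` is (the input part of) a solution of: minimize `C(u)` over all feasible `(u, λ)`. -/
def IsOptimalInput (S : FlowSystem V ι κ) (xbar : V → ℝ) (u : S.Ve → ℝ) : Prop :=
  (∃ lam, S.Feasible xbar u lam) ∧ ∀ u' lam', S.Feasible xbar u' lam' → S.cost u ≤ S.cost u'

/-- `d̂ = d + E_c η(E_cᵀ h(x̄))`. -/
def dHat (S : FlowSystem V ι κ) (xbar : V → ℝ) : V → ℝ :=
  S.d + S.Ec.mulVec (mapVec S.eta (S.Ec.transpose.mulVec (mapVec S.h xbar)))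

/-- The common value of the entries of
`κ̂ = Eᵀ (𝟙 𝟙ᵀ / (𝟙ᵀ Q⁻¹ 𝟙)) (d̂ + E Q⁻¹ r)`. -/
noncomputable def kappaHat (S : FlowSystem V ι κ) (xbar : V → ℝ) : ℝ :=
  (∑ i, (S.dHat xbar + S.E.mulVec (fun j => S.r j / S.q j)) i) / ∑ j, 1 / S.q j

/-- `û = Q⁻¹ (κ̂ - r)`. -/
noncomputable def uHat (S : FlowSystem V ι κ) (xbar : V → ℝ) : S.Ve → ℝ :=
  fun j => (S.kappaHat xbar - S.r j) / S.q j

/-- Attainability: some `B⁺ (Ψ(x̄) + E û - d) + (I - B⁺ B) ω` has its entries in the ranges of the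
`f_k`, where `B⁺` is the Moore-Penrose pseudoinverse of `B`, and `û_i` is in the range of `g_i`. -/
def Attainable (S : FlowSystem V ι κ) (xbar : V → ℝ) : Prop :=
  (∃ P, IsMoorePenrose S.B P ∧ ∃ om : ι → ℝ, ∀ k,
    (P.mulVec (S.Psi xbar + S.E.mulVec (S.uHat xbar) - S.d)
      + (om - P.mulVec (S.B.mulVec om))) k ∈ range (S.f k)) ∧
  ∀ i, S.uHat xbar i ∈ range (S.g i)

/-- The nodes of `Vc` whose outflow function has positive derivative at the steady state. -/
def Vs (S : FlowSystem V ι κ) (xbar : V → ℝ) : Set V :=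
  {i | ∃ hi : i ∈ S.Vc,
    0 < deriv (S.eta ⟨i, hi⟩) (S.Ec.transpose.mulVec (mapVec S.h xbar) ⟨i, hi⟩)}

/-- The set `Υ₄`, for a given steady state `(x̄, μ̄, θ̄, φ̄)`. -/
def Upsilon (S : FlowSystem V ι κ) (zbar : S.State) : Set S.State :=
  {z | S.B.mulVec (mapVec S.f z.2.1 - mapVec S.f zbar.2.1) = 0 ∧
    z.1 = zbar.1 ∧ z.2.2.1 = zbar.2.2.1 ∧ z.2.2.2 = zbar.2.2.2}

end FlowSystem

/-! Optimality. Summing the constraint over the nodes kills every incidence matrix, so feasible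
inputs all have the same total. The input `û` has that total and equal marginal costs, hence the
excess cost of any feasible input over it is a sum of squares (`cost_eq`). Feasibility of `û` with
attainable flows holds because `B B⁺` fixes the vectors of zero sum on a connected graph.

Dissipation. Relative to any steady state `p`, the sum of the weighted potentials `T ∫ (F s - F p)
ds` of all scalar output functions is a storage function. Along the closed loop the exchange terms
through `B` and `E` cancel, leaving minus the sum of two monotone forms from `γ` and `η`, of `‖g(θ)
- φ‖²` and of a Laplacian form (`storageDeriv_field`). The potentials grow at least linearly even
when `f` and `g` are bounded, so sublevel sets are compact and solutions are global.

Invariance. Every solution has an ω-limit point from which a solution without dissipation starts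
(`exists_limit_solution`). Along the latter `Ψ(x)`, `φ` and `g(θ)` are constant, so `θ` is at rest,
which forces `x = x̄` on the controlled nodes; a positive derivative of `η` forces it on `Vs`. Zero
forcing spreads this to all nodes (`forcing_step`): if a node and all its neighbours but one are at
`x̄`, its net outflow is constant, yet each edge flow towards the last neighbour is strictly
monotone in the integrated output error there, so that error vanishes. Only monotonicity of `f`
enters this step; no linearization is made.

Convergence to a point. The ω-limit point is thus itself a steady state. Taking it as the base point
of the storage function makes it the strict global minimum, so the solution converges to it
(`tendsto_of_mapClusterPt`). -/

set_option linter.unusedSectionVars false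

/-! ### Global existence and the invariance principle for Lyapunov functions -/

section Flow

variable {X : Type*} [NormedAddCommGroup X] [NormedSpace ℝ X]

/-- `z` solves the autonomous differential equation `z' = F z` on `[0, ∞)`. -/
def SolvesODE (F : X → X) (z : ℝ → X) : Prop :=
  ∀ t, 0 ≤ t → HasDerivWithinAt z (F (z t)) (Ici 0) t

theorem SolvesODE.continuousOn {F : X → X} {z : ℝ → X} (hz : SolvesODE F z) :
    ContinuousOn z (Ici 0) := fun t ht => (hz t ht).continuousWithinAt

theorem SolvesODE.shift {F : X → X} {z : ℝ → X} (hz : SolvesODE F z) {s : ℝ} (hs : 0 ≤ s) :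
    SolvesODE F (fun t => z (s + t)) := by
  intro t ht
  have h1 : HasDerivWithinAt (fun t : ℝ => s + t) 1 (Ici 0) t :=
    ((hasDerivAt_id t).const_add s).hasDerivWithinAt
  have h2 := (hz (s + t) (add_nonneg hs ht)).scomp t h1
    (fun r hr => mem_Ici.2 (add_nonneg hs (mem_Ici.1 hr)))
  simpa using! h2

/-- Grönwall's estimate. `F` is only locally Lipschitz in the application, so `G` is a cutoff of it
that agrees with it along both trajectories. -/
theorem SolvesODE.dist_le {F G : X → X} {K : NNReal} (hG : LipschitzWith K G) {y z : ℝ → X}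
    (hy : SolvesODE F y) (hz : SolvesODE F z) (hyG : ∀ t, 0 ≤ t → F (y t) = G (y t))
    (hzG : ∀ t, 0 ≤ t → F (z t) = G (z t)) {t : ℝ} (ht : 0 ≤ t) :
    dist (y t) (z t) ≤ dist (y 0) (z 0) * Real.exp (K * t) := by
  have := dist_le_of_trajectories_ODE (v := fun _ => G) (f := y) (g := z) (a := 0) (b := t)
    (fun _ => hG) (hy.continuousOn.mono Icc_subset_Ici_self)
    (fun s hs => by rw [← hyG s hs.1]; exact (hy s hs.1).mono (Ici_subset_Ici.2 hs.1))
    (hz.continuousOn.mono Icc_subset_Ici_self)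
    (fun s hs => by rw [← hzG s hs.1]; exact (hz s hs.1).mono (Ici_subset_Ici.2 hs.1))
    le_rfl t ⟨ht, le_rfl⟩
  simpa using this

theorem exists_solvesODE_of_lipschitz_bounded [CompleteSpace X] {G : X → X} {K L : NNReal}
    (hG : LipschitzWith K G) (hL : ∀ x, ‖G x‖ ≤ L) (x₀ : X) :
    ∃ z, SolvesODE G z ∧ z 0 = x₀ := by
  have key : ∀ n : ℕ, ∃ α : ℝ → X, α 0 = x₀ ∧
      ∀ t ∈ Icc (0 : ℝ) n, HasDerivWithinAt α (G (α t)) (Icc (0 : ℝ) n) t := by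
    intro n
    have h0 : (0 : ℝ) ∈ Icc (0 : ℝ) n := ⟨le_rfl, n.cast_nonneg⟩
    -- With speed at most `L`, a solution stays within `L * n` of `x₀` up to time `n`; the global
    -- bound thus allows intervals of any length.
    have hpl : IsPicardLindelof (fun _ : ℝ => G) (⟨0, h0⟩ : Icc (0 : ℝ) n) x₀ (L * n) 0 L K :=
      { lipschitzOnWith := fun t _ => hG.lipschitzOnWith
        continuousOn := fun x _ => continuousOn_const
        norm_le := fun t _ x _ => hL x
        mul_max_le := by simp }
    exact hpl.exists_eq_forall_mem_Icc_hasDerivWithinAt₀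
  choose α hα0 hα using key
  have agree : ∀ m n : ℕ, m ≤ n → EqOn (α m) (α n) (Icc (0 : ℝ) m) := by
    intro m n hmn
    have hsub : Icc (0 : ℝ) m ⊆ Icc (0 : ℝ) n := Icc_subset_Icc_right (Nat.cast_le.2 hmn)
    have hright : ∀ k : ℕ, ∀ t ∈ Ico (0 : ℝ) k,
        HasDerivWithinAt (α k) (G (α k t)) (Ici t) t := by
      intro k t ht
      refine (hα k t (Ico_subset_Icc_self ht)).mono_of_mem_nhdsWithin ?_
      exact mem_of_superset (Icc_mem_nhdsGE ht.2) (Icc_subset_Icc_left ht.1)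
    exact ODE_solution_unique (v := fun _ => G) (fun _ => hG)
      (fun t ht => (hα m t ht).continuousWithinAt) (hright m)
      (fun t ht => ((hα n t (hsub ht)).continuousWithinAt).mono hsub)
      (fun t ht => hright n t ⟨ht.1, ht.2.trans_le (Nat.cast_le.2 hmn)⟩)
      ((hα0 m).trans (hα0 n).symm)
  -- The index `⌊t⌋₊ + 1` puts `t` strictly before the right end of the interval on which that
  -- solution is defined.
  let z : ℝ → X := fun t => α (⌊t⌋₊ + 1) t
  have hz : ∀ n : ℕ, EqOn z (α n) (Ico (0 : ℝ) n) := by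
    intro n t ht
    have h1 : ⌊t⌋₊ + 1 ≤ n := (Nat.floor_lt ht.1).2 ht.2
    exact agree _ _ h1 ⟨ht.1, by simpa using (Nat.lt_floor_add_one t).le⟩
  refine ⟨z, fun t ht => ?_, hα0 _⟩
  obtain ⟨n, hn⟩ := exists_nat_gt t
  have hd : HasDerivWithinAt (α n) (G (α n t)) (Ico (0 : ℝ) n) t :=
    (hα n t ⟨ht, hn.le⟩).mono Ico_subset_Icc_self
  rw [hz n ⟨ht, hn⟩]
  refine (hd.congr (hz n) (hz n ⟨ht, hn⟩)).mono_of_mem_nhdsWithin ?_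
  filter_upwards [self_mem_nhdsWithin, mem_nhdsWithin_of_mem_nhds (Iio_mem_nhds hn)] with s h1 h2
  exact ⟨h1, h2⟩

theorem exists_lipschitz_cutoff [FiniteDimensional ℝ X] {F : X → X} (hF : ContDiff ℝ 1 F)
    {A : Set X} (hA : Bornology.IsBounded A) :
    ∃ (χ : X → ℝ) (K L : NNReal), (∀ x, 0 ≤ χ x) ∧ (∀ x ∈ A, χ x = 1) ∧
      LipschitzWith K (fun x => χ x • F x) ∧ ∀ x, ‖χ x • F x‖ ≤ L := by
  obtain ⟨R, hR0, hR⟩ := hA.subset_closedBall_lt 0 0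
  let χ : ContDiffBump (0 : X) := ⟨R, R + 1, hR0, by linarith⟩
  have hc : ContDiff ℝ 1 (fun x => χ x • F x) := χ.contDiff.smul hF
  have hs : HasCompactSupport (fun x => χ x • F x) := χ.hasCompactSupport.smul_right
  obtain ⟨K, hK⟩ := ContDiff.lipschitzWith_of_hasCompactSupport hs hc one_ne_zero
  obtain ⟨L, hL⟩ := hs.exists_bound_of_continuous hc.continuous
  refine ⟨χ, K, L.toNNReal, fun x => χ.nonneg, fun x hx => χ.one_of_mem_closedBall (hR hx), hK,
    fun x => (hL x).trans (Real.le_coe_toNNReal L)⟩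

/-- A differentiable function with bounded sublevel sets that does not increase along the vector
field `F`. -/
structure IsLyapunov (F : X → X) (W : X → ℝ) (W' : X → X →L[ℝ] ℝ) : Prop where
  hasFDerivAt : ∀ x, HasFDerivAt W (W' x) x
  nonpos : ∀ x, W' x (F x) ≤ 0
  bounded : ∀ c, Bornology.IsBounded {x | W x ≤ c}

namespace IsLyapunov

variable {F : X → X} {W : X → ℝ} {W' : X → X →L[ℝ] ℝ}

theorem continuous (h : IsLyapunov F W W') : Continuous W :=
  continuous_iff_continuousAt.2 fun x => (h.hasFDerivAt x).continuousAt

theorem hasDerivWithinAt (h : IsLyapunov F W W') {z : ℝ → X} (hz : SolvesODE F z) {t : ℝ}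
    (ht : 0 ≤ t) : HasDerivWithinAt (fun s => W (z s)) (W' (z t) (F (z t))) (Ici 0) t :=
  (h.hasFDerivAt (z t)).comp_hasDerivWithinAt t (hz t ht)

theorem antitoneOn (h : IsLyapunov F W W') {z : ℝ → X} (hz : SolvesODE F z) :
    AntitoneOn (fun t => W (z t)) (Ici 0) := by
  refine antitoneOn_of_hasDerivWithinAt_nonpos (f' := fun t => W' (z t) (F (z t))) (convex_Ici 0)
    (fun t ht => (h.hasDerivWithinAt hz ht).continuousWithinAt) (fun t ht => ?_)
    (fun t _ => h.nonpos _)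
  rw [interior_Ici] at ht ⊢
  exact (h.hasDerivWithinAt hz (le_of_lt ht)).mono Ioi_subset_Ici_self

/-- A nonnegative cutoff only slows the motion down, so the same `W` confines the solutions of the
cutoff field to the region where the cutoff equals one. -/
theorem mono_smul (h : IsLyapunov F W W') {χ : X → ℝ} (hχ : ∀ x, 0 ≤ χ x) :
    IsLyapunov (fun x => χ x • F x) W W' where
  hasFDerivAt := h.hasFDerivAt
  nonpos x := by
    rw [map_smul, smul_eq_mul]
    exact mul_nonpos_of_nonneg_of_nonpos (hχ x) (h.nonpos x)
  bounded := h.bounded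

theorem le_initial (h : IsLyapunov F W W') {z : ℝ → X} (hz : SolvesODE F z) {t : ℝ}
    (ht : 0 ≤ t) : W (z t) ≤ W (z 0) := h.antitoneOn hz (mem_Ici.2 le_rfl) ht ht

theorem exists_solvesODE [FiniteDimensional ℝ X] (h : IsLyapunov F W W') (hF : ContDiff ℝ 1 F)
    (x₀ : X) : ∃ z, SolvesODE F z ∧ z 0 = x₀ := by
  have : CompleteSpace X := FiniteDimensional.complete ℝ X
  obtain ⟨χ, K, L, hχ0, hχ1, hK, hL⟩ := exists_lipschitz_cutoff hF (h.bounded (W x₀))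
  obtain ⟨z, hz, hz0⟩ := exists_solvesODE_of_lipschitz_bounded hK hL x₀
  refine ⟨z, fun t ht => ?_, hz0⟩
  have h1 : W (z t) ≤ W x₀ := hz0 ▸ (h.mono_smul hχ0).le_initial hz ht
  have h2 : HasDerivWithinAt z (χ (z t) • F (z t)) (Ici 0) t := hz t ht
  rwa [hχ1 _ h1, one_smul] at h2

theorem isCompact_sublevel [FiniteDimensional ℝ X] (h : IsLyapunov F W W') (c : ℝ) :
    IsCompact {x | W x ≤ c} := by
  have : ProperSpace X := FiniteDimensional.proper ℝ X
  exact Metric.isCompact_of_isClosed_isBounded (isClosed_le h.continuous continuous_const)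
    (h.bounded c)

/-- Every solution has an ω-limit point through which there is a solution along which the Lyapunov
function is constant. -/
theorem exists_limit_solution [FiniteDimensional ℝ X] (h : IsLyapunov F W W')
    (hF : ContDiff ℝ 1 F) {z : ℝ → X} (hz : SolvesODE F z) :
    ∃ y, SolvesODE F y ∧ MapClusterPt (y 0) atTop z ∧ ∀ s, 0 ≤ s → W' (y s) (F (y s)) = 0 := by
  have hK := h.isCompact_sublevel (W (z 0))
  have hmem : ∀ n : ℕ, z n ∈ {x | W x ≤ W (z 0)} := fun n => h.le_initial hz n.cast_nonneg
  obtain ⟨p, hp, φ, hφ, hlim⟩ := hK.tendsto_subseq hmem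
  obtain ⟨y, hy, hy0⟩ := h.exists_solvesODE hF p
  have hφt : Tendsto (fun n => (φ n : ℝ)) atTop atTop :=
    tendsto_natCast_atTop_atTop.comp hφ.tendsto_atTop
  obtain ⟨χ, K, L, hχ0, hχ1, hKL, hL⟩ := exists_lipschitz_cutoff hF (h.bounded (W (z 0)))
  have hyG : ∀ t, 0 ≤ t → F (y t) = χ (y t) • F (y t) := fun t ht => by
    rw [hχ1 _ ((h.le_initial hy ht).trans (hy0.symm ▸ hp)), one_smul]
  have hzG : ∀ t, 0 ≤ t → F (z t) = χ (z t) • F (z t) := fun t ht => by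
    rw [hχ1 _ (h.le_initial hz ht), one_smul]
  -- Continuous dependence on the initial value: the shifted solutions start at points tending to
  -- `p`.
  have hshift : ∀ s, 0 ≤ s → Tendsto (fun n => z (φ n + s)) atTop (𝓝 (y s)) := by
    intro s hs
    rw [tendsto_iff_dist_tendsto_zero]
    have h1 : Tendsto (fun n => dist (z (φ n)) p * Real.exp (K * s)) atTop (𝓝 0) := by
      simpa using (tendsto_iff_dist_tendsto_zero.1 hlim).mul_const (Real.exp (K * s))
    refine squeeze_zero (fun _ => dist_nonneg) (fun n => ?_) h1
    have hn : (0 : ℝ) ≤ φ n := Nat.cast_nonneg _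
    have := (hz.shift hn).dist_le hKL hy (fun t ht => hzG _ (add_nonneg hn ht)) hyG hs
    simpa [hy0] using this
  have hbdd : BddBelow ((fun t => W (z t)) '' Ici 0) := by
    obtain ⟨b, hb⟩ := (hK.image h.continuous).bddBelow
    refine ⟨b, ?_⟩
    rintro _ ⟨t, ht, rfl⟩
    exact hb ⟨z t, h.le_initial hz ht, rfl⟩
  obtain ⟨w, hw⟩ : ∃ w, Tendsto (fun t => W (z t)) atTop (𝓝 w) := by
    have hanti : Antitone (fun t => W (z (max t 0))) := fun a b hab =>
      h.antitoneOn hz (le_max_right a 0) (le_max_right b 0) (max_le_max_right 0 hab)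
    have hb : BddBelow (range fun t => W (z (max t 0))) := hbdd.mono (by
      rintro _ ⟨t, rfl⟩
      exact ⟨_, le_max_right t 0, rfl⟩)
    refine ⟨_, (tendsto_atTop_ciInf hanti hb).congr' ?_⟩
    filter_upwards [eventually_ge_atTop 0] with t ht
    rw [max_eq_left ht]
  -- `W ∘ z` decreases to `w`, and `y s` is a limit of points of `z` at times tending to infinity.
  have hconst : ∀ s, 0 ≤ s → W (y s) = w := fun s hs =>
    tendsto_nhds_unique ((h.continuous.tendsto _).comp (hshift s hs))
      (hw.comp (tendsto_atTop_add_const_right _ s hφt))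
  refine ⟨y, hy, ?_, fun s hs => ?_⟩
  · rw [hy0]
    exact (hlim.mapClusterPt).of_comp hφt
  · have h1 := h.hasDerivWithinAt hy hs
    have h2 : HasDerivWithinAt (fun s => W (y s)) 0 (Ici 0) s :=
      (hasDerivWithinAt_const s _ w).congr (fun r hr => hconst r hr) (hconst s hs)
    exact (uniqueDiffOn_Ici (0 : ℝ) s hs).eq_deriv _ h1 h2

/-- A solution converges to each of its cluster points at which some Lyapunov function has a strict
global minimum. -/
theorem tendsto_of_mapClusterPt [FiniteDimensional ℝ X] (h : IsLyapunov F W W') {p : X}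
    (hp : ∀ x, W x ≤ W p → x = p) {z : ℝ → X} (hz : SolvesODE F z) (hzp : MapClusterPt p atTop z) :
    Tendsto z atTop (𝓝 p) := by
  -- Once `W` has dropped below `c` near the cluster point it stays there; hence every cluster point
  -- `q` has `W q ≤ W p`.
  have hev : ∀ c, W p < c → ∀ᶠ t in atTop, W (z t) ≤ c := by
    intro c hc
    have h1 : ∃ᶠ t in atTop, W (z t) < c :=
      (hzp.frequently ((h.continuous.tendsto p).eventually (gt_mem_nhds hc)))
    obtain ⟨t₀, ht₀, ht₀c⟩ := (h1.and_eventually (eventually_ge_atTop 0)).exists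
    filter_upwards [eventually_ge_atTop t₀] with t ht
    exact (h.antitoneOn hz ht₀c (ht₀c.trans ht) ht).trans ht₀.le
  refine (h.isCompact_sublevel (W (z 0))).tendsto_nhds_of_unique_mapClusterPt ?_ fun q _ hq => hp q ?_
  · filter_upwards [eventually_ge_atTop 0] with t ht using h.le_initial hz ht
  · refine le_of_forall_gt_imp_ge_of_dense fun c hc => ?_
    by_contra! hlt
    exact (hq.frequently ((h.continuous.tendsto q).eventually (lt_mem_nhds hlt))).and_eventually
      (hev c hc) |>.exists.elim fun t ht => absurd ht.1 (not_lt.2 ht.2)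

end IsLyapunov

end Flow

/-! ### Potentials of strictly increasing functions -/

section Potential

/-- The potential `∫ₐˣ (F s - F a) ds`. -/
noncomputable def potential (F : ℝ → ℝ) (a x : ℝ) : ℝ := ∫ s in a..x, (F s - F a)

variable {F : ℝ → ℝ}

theorem hasDerivAt_potential (hc : Continuous F) (a x : ℝ) :
    HasDerivAt (potential F a) (F x - F a) x := by
  have hc' : Continuous fun s => F s - F a := hc.sub continuous_const
  exact intervalIntegral.integral_hasDerivAt_right (hc'.intervalIntegrable _ _)
    (hc'.stronglyMeasurableAtFilter _ _) hc'.continuousAt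

@[simp] theorem potential_self (a : ℝ) : potential F a a = 0 := by simp [potential]

/-- The potential of a strictly increasing function lies above its tangents. -/
theorem potential_tangent_le (hc : Continuous F) (hm : StrictMono F) (a b x : ℝ) :
    potential F a b + (F b - F a) * (x - b) ≤ potential F a x := by
  rcases lt_trichotomy x b with h | rfl | h
  · obtain ⟨ξ, hξ, h1⟩ := exists_hasDerivAt_eq_slope (potential F a) _ h
      (fun y _ => (hasDerivAt_potential hc a y).continuousAt.continuousWithinAt)
      (fun y _ => hasDerivAt_potential hc a y)
    rw [eq_div_iff (by linarith)] at h1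
    have := hm hξ.2
    nlinarith
  · simp
  · obtain ⟨ξ, hξ, h1⟩ := exists_hasDerivAt_eq_slope (potential F a) _ h
      (fun y _ => (hasDerivAt_potential hc a y).continuousAt.continuousWithinAt)
      (fun y _ => hasDerivAt_potential hc a y)
    rw [eq_div_iff (by linarith)] at h1
    have := hm hξ.1
    nlinarith

theorem potential_nonneg (hc : Continuous F) (hm : StrictMono F) (a x : ℝ) :
    0 ≤ potential F a x := by
  simpa using potential_tangent_le hc hm a a x

/-- The tangent at the midpoint of `a` and `x` starts at a nonnegative value and rises strictly
towards `x`. -/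
theorem potential_pos (hc : Continuous F) (hm : StrictMono F) {a x : ℝ} (hx : x ≠ a) :
    0 < potential F a x := by
  have h1 := potential_tangent_le hc hm a ((a + x) / 2) x
  have h2 := potential_nonneg hc hm a ((a + x) / 2)
  have h3 : 0 < (F ((a + x) / 2) - F a) * (x - (a + x) / 2) := by
    rcases lt_or_gt_of_ne hx with h | h
    · have := hm (show (a + x) / 2 < a by linarith)
      exact mul_pos_of_neg_of_neg (by linarith) (by linarith)
    · have := hm (show a < (a + x) / 2 by linarith)
      exact mul_pos (by linarith) (by linarith)
  linarith

/-- The tangents at `a + 1` and `a - 1` have nonzero slopes of opposite sign, so the potential grows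
at least linearly on both sides, even for bounded `F`. -/
theorem exists_dist_le_of_potential_le (hc : Continuous F) (hm : StrictMono F) (a c : ℝ) :
    ∃ R, ∀ x, potential F a x ≤ c → dist x a ≤ R := by
  have hp : 0 < F (a + 1) - F a := sub_pos.2 (hm (by linarith))
  have hn : 0 < F a - F (a - 1) := sub_pos.2 (hm (by linarith))
  refine ⟨max (c / (F (a + 1) - F a) + 1) (c / (F a - F (a - 1)) + 1), fun x hx => ?_⟩
  have h1 := potential_tangent_le hc hm a (a + 1) x
  have h2 := potential_tangent_le hc hm a (a - 1) x
  have h3 := potential_nonneg hc hm a (a + 1)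
  have h4 := potential_nonneg hc hm a (a - 1)
  rw [Real.dist_eq, abs_le]
  have h5 : x - a - 1 ≤ c / (F (a + 1) - F a) := by
    rw [le_div_iff₀ hp]; nlinarith
  have h6 : a - x - 1 ≤ c / (F a - F (a - 1)) := by
    rw [le_div_iff₀ hn]; nlinarith
  have h7 := le_max_left (c / (F (a + 1) - F a) + 1) (c / (F a - F (a - 1)) + 1)
  have h8 := le_max_right (c / (F (a + 1) - F a) + 1) (c / (F a - F (a - 1)) + 1)
  constructor <;> linarith

variable {α : Type*} [Fintype α]

/-- The weighted sum of the potentials of the scalar functions `F i` with base points `a i`. -/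
noncomputable def potentialSum (T : α → ℝ) (F : α → ℝ → ℝ) (a x : α → ℝ) : ℝ :=
  ∑ i, T i * potential (F i) (a i) (x i)

/-- The derivative of `potentialSum`. -/
noncomputable def potentialSumDeriv (T : α → ℝ) (F : α → ℝ → ℝ) (a x : α → ℝ) :
    (α → ℝ) →L[ℝ] ℝ :=
  ∑ i, (T i * (F i (x i) - F i (a i))) • ContinuousLinearMap.proj i

variable {T : α → ℝ} {F : α → ℝ → ℝ}

theorem potentialSumDeriv_apply (a x v : α → ℝ) :
    potentialSumDeriv T F a x v = ∑ i, T i * (F i (x i) - F i (a i)) * v i := by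
  simp [potentialSumDeriv]

theorem potentialSumDeriv_apply_div (hT : ∀ i, 0 < T i) (a x v : α → ℝ) :
    potentialSumDeriv T F a x (fun i => v i / T i) = (mapVec F x - mapVec F a) ⬝ᵥ v := by
  rw [potentialSumDeriv_apply, dotProduct]
  refine Finset.sum_congr rfl fun i _ => ?_
  have := (hT i).ne'
  simp only [Pi.sub_apply, mapVec]
  field_simp

theorem hasFDerivAt_potentialSum (hc : ∀ i, Continuous (F i)) (a x : α → ℝ) :
    HasFDerivAt (potentialSum T F a) (potentialSumDeriv T F a x) x := by
  unfold potentialSum potentialSumDeriv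
  refine HasFDerivAt.fun_sum fun i _ => ?_
  have h1 : HasFDerivAt (fun y : α → ℝ => y i) (ContinuousLinearMap.proj (R := ℝ) i) x :=
    hasFDerivAt_apply i x
  have h2 := (((hasDerivAt_potential (hc i) (a i) (x i)).const_mul (T i)).comp_hasFDerivAt x h1)
  exact h2

theorem potentialSum_self (a : α → ℝ) : potentialSum T F a a = 0 := by simp [potentialSum]

theorem potentialSum_nonneg (hT : ∀ i, 0 < T i) (hc : ∀ i, Continuous (F i))
    (hm : ∀ i, StrictMono (F i)) (a x : α → ℝ) : 0 ≤ potentialSum T F a x :=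
  Finset.sum_nonneg fun i _ => mul_nonneg (hT i).le (potential_nonneg (hc i) (hm i) _ _)

theorem mul_potential_le_potentialSum (hT : ∀ i, 0 < T i) (hc : ∀ i, Continuous (F i))
    (hm : ∀ i, StrictMono (F i)) (a x : α → ℝ) (i : α) :
    T i * potential (F i) (a i) (x i) ≤ potentialSum T F a x :=
  Finset.single_le_sum (f := fun i => T i * potential (F i) (a i) (x i))
    (fun j _ => mul_nonneg (hT j).le (potential_nonneg (hc j) (hm j) _ _)) (Finset.mem_univ i)

theorem eq_of_potentialSum_nonpos (hT : ∀ i, 0 < T i) (hc : ∀ i, Continuous (F i))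
    (hm : ∀ i, StrictMono (F i)) {a x : α → ℝ} (h : potentialSum T F a x ≤ 0) : x = a := by
  funext i
  by_contra hne
  have h1 := mul_potential_le_potentialSum hT hc hm a x i
  have h2 := mul_pos (hT i) (potential_pos (hc i) (hm i) hne)
  linarith

theorem isBounded_potentialSum_le (hT : ∀ i, 0 < T i) (hc : ∀ i, Continuous (F i))
    (hm : ∀ i, StrictMono (F i)) (a : α → ℝ) (c : ℝ) :
    Bornology.IsBounded {x | potentialSum T F a x ≤ c} := by
  choose R hR using fun i => exists_dist_le_of_potential_le (hc i) (hm i) (a i) (c / T i)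
  -- Absolute values are needed since `R i` may be negative when a sublevel set is empty.
  refine (Metric.isBounded_closedBall (x := a) (r := ∑ i, |R i|)).subset fun x hx => ?_
  rw [Metric.mem_closedBall, dist_pi_le_iff (Finset.sum_nonneg fun i _ => abs_nonneg _)]
  intro i
  have h1 := mul_potential_le_potentialSum hT hc hm a x i
  have h2 : dist (x i) (a i) ≤ R i := by
    apply hR
    rw [le_div_iff₀ (hT i), mul_comm]
    exact h1.trans hx
  exact h2.trans ((le_abs_self _).trans
    (Finset.single_le_sum (f := fun i => |R i|) (fun j _ => abs_nonneg _) (Finset.mem_univ i)))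

end Potential

/-! ### Incidence matrices and selection matrices -/

namespace OrientedGraph

variable {V ι : Type*} [Fintype V] [Fintype ι] [DecidableEq V] (G : OrientedGraph V ι)

theorem transpose_incidence_mulVec_apply (v : V → ℝ) (k : ι) :
    (G.incidence.transpose.mulVec v) k = v (G.pos k) - v (G.neg k) := by
  have h1 : ∀ i, G.incidence i k * v i
      = (if i = G.pos k then v i else 0) - (if i = G.neg k then v i else 0) := by
    intro i
    have := G.ne k
    simp only [incidence, Matrix.of_apply]
    split_ifs with h2 h3 <;> simp_all
  simp [Matrix.mulVec, dotProduct, h1, Finset.sum_sub_distrib]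

theorem dotProduct_incidence_mulVec (v : V → ℝ) (l : ι → ℝ) :
    v ⬝ᵥ G.incidence.mulVec l = G.incidence.transpose.mulVec v ⬝ᵥ l := by
  rw [Matrix.dotProduct_mulVec, Matrix.mulVec_transpose]

theorem sum_incidence_mulVec (l : ι → ℝ) : ∑ i, G.incidence.mulVec l i = 0 := by
  have h1 := G.dotProduct_incidence_mulVec (fun _ => 1) l
  have h2 : G.incidence.transpose.mulVec (fun _ => (1 : ℝ)) = 0 := by
    funext k; simp [transpose_incidence_mulVec_apply]
  rw [h2, zero_dotProduct] at h1
  simpa [dotProduct] using h1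

theorem eq_of_transpose_incidence_mulVec_eq_zero (hG : G.graph.Connected) {v : V → ℝ}
    (hv : G.incidence.transpose.mulVec v = 0) (i j : V) : v i = v j := by
  obtain ⟨p⟩ := hG.preconnected i j
  induction p with
  | nil => rfl
  | cons hadj _ ih =>
    rw [← ih]
    obtain ⟨k, hk⟩ := hadj
    have h1 := congrFun hv k
    rw [transpose_incidence_mulVec_apply, Pi.zero_apply, sub_eq_zero] at h1
    rcases hk with ⟨rfl, rfl⟩ | ⟨rfl, rfl⟩
    exacts [h1, h1.symm]

/-- `A A⁺` fixes the vectors with zero sum, when `A` is the incidence matrix of a connected graph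
and `A⁺` its pseudoinverse. -/
theorem incidence_mulVec_pinv_mulVec (hG : G.graph.Connected) {P : Matrix ι V ℝ}
    (hP : IsMoorePenrose G.incidence P) {b : V → ℝ} (hb : ∑ i, b i = 0) :
    G.incidence.mulVec (P.mulVec b) = b := by
  obtain ⟨hP1, -, hP3, -⟩ := hP
  set A := G.incidence with hA
  -- Symmetry of `A P` makes the residual `b - A P b` lie in the kernel of `Aᵀ`. It is therefore
  -- constant over the nodes, and having zero sum it vanishes.
  have h0 : A.transpose * (A * P) = A.transpose := by
    conv_lhs => rw [← hP3]
    rw [← Matrix.transpose_mul, hP1]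
  have h1 : A.transpose.mulVec (b - A.mulVec (P.mulVec b)) = 0 := by
    rw [Matrix.mulVec_sub, Matrix.mulVec_mulVec, Matrix.mulVec_mulVec, Matrix.mul_assoc, h0,
      sub_self]
  have h2 := G.eq_of_transpose_incidence_mulVec_eq_zero hG h1
  have h3 : ∑ i, (b - A.mulVec (P.mulVec b)) i = 0 := by
    simp only [Pi.sub_apply, Finset.sum_sub_distrib, hb, hA, sum_incidence_mulVec, sub_zero]
  funext i
  have : Nonempty V := ⟨i⟩
  have h4 : ∑ j, (b - A.mulVec (P.mulVec b)) j = Fintype.card V * (b - A.mulVec (P.mulVec b)) i := by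
    rw [Finset.sum_congr rfl fun j _ => h2 j i, Finset.sum_const, Finset.card_univ, nsmul_eq_mul]
  rw [h4, mul_eq_zero, Nat.cast_eq_zero] at h3
  have h5 := h3.resolve_left Fintype.card_ne_zero
  rw [Pi.sub_apply] at h5
  linarith

end OrientedGraph

section Selection

variable {V : Type*} [Fintype V] [DecidableEq V] (s : Finset V)

theorem transpose_selection_mulVec_apply (v : V → ℝ) (j : s) :
    (selection s).transpose.mulVec v j = v j := by
  simp [selection, Matrix.mulVec, dotProduct]

theorem dotProduct_selection_mulVec (v : V → ℝ) (u : s → ℝ) :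
    v ⬝ᵥ (selection s).mulVec u = ∑ j : s, v j * u j := by
  rw [Matrix.dotProduct_mulVec, ← Matrix.mulVec_transpose]
  simp [dotProduct, transpose_selection_mulVec_apply]

theorem sum_selection_mulVec (u : s → ℝ) : ∑ i, (selection s).mulVec u i = ∑ j, u j := by
  simpa [dotProduct] using dotProduct_selection_mulVec s (fun _ => 1) u

end Selection

namespace FlowSystem

variable {V ι κ : Type*} [Fintype V] [Fintype ι] [Fintype κ] [DecidableEq V]
  {S : FlowSystem V ι κ}

/-! ### The Laplacian of a balanced digraph -/

section Laplacian

theorem Lcom_mulVec_apply (v : S.Ve → ℝ) (i : S.Ve) :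
    S.Lcom.mulVec v i = ∑ j, S.w i j * (v i - v j) := by
  simp only [Lcom, Matrix.sub_mulVec, Pi.sub_apply, Matrix.mulVec_diagonal, mul_sub,
    Finset.sum_sub_distrib, Finset.sum_mul]
  rfl

theorem sum_Lcom_mulVec (hcom : S.GoodCommunication) (v : S.Ve → ℝ) :
    ∑ i, S.Lcom.mulVec v i = 0 := by
  simp only [Lcom_mulVec_apply, mul_sub, Finset.sum_sub_distrib]
  rw [Finset.sum_comm (f := fun i j => S.w i j * v j), sub_eq_zero]
  refine Finset.sum_congr rfl fun i _ => ?_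
  rw [← Finset.sum_mul, ← Finset.sum_mul, hcom.balanced]

/-- Balance makes the weighted sums of `v i ^ 2` and of `v j ^ 2` equal, so the form symmetrizes
although `w` need not be symmetric. -/
theorem dotProduct_Lcom_mulVec (hcom : S.GoodCommunication) (v : S.Ve → ℝ) :
    v ⬝ᵥ S.Lcom.mulVec v = 1 / 2 * ∑ i, ∑ j, S.w i j * (v i - v j) ^ 2 := by
  have h1 : ∑ i, ∑ j, S.w i j * v i ^ 2 = ∑ i, ∑ j, S.w i j * v j ^ 2 := by
    rw [Finset.sum_comm (f := fun i j => S.w i j * v j ^ 2)]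
    refine Finset.sum_congr rfl fun i _ => ?_
    rw [← Finset.sum_mul, ← Finset.sum_mul, hcom.balanced]
  have h2 : v ⬝ᵥ S.Lcom.mulVec v = ∑ i, ∑ j, S.w i j * v i ^ 2 - ∑ i, ∑ j, S.w i j * (v i * v j) := by
    simp only [dotProduct, Lcom_mulVec_apply, ← Finset.sum_sub_distrib, Finset.mul_sum]
    exact Finset.sum_congr rfl fun i _ => Finset.sum_congr rfl fun j _ => by ring
  have h3 : ∑ i, ∑ j, S.w i j * (v i - v j) ^ 2 = ∑ i, ∑ j, S.w i j * v i ^ 2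
      - 2 * ∑ i, ∑ j, S.w i j * (v i * v j) + ∑ i, ∑ j, S.w i j * v j ^ 2 := by
    simp only [← Finset.sum_sub_distrib, ← Finset.sum_add_distrib, Finset.mul_sum]
    exact Finset.sum_congr rfl fun i _ => Finset.sum_congr rfl fun j _ => by ring
  rw [h2, h3, ← h1]
  ring

theorem dotProduct_Lcom_mulVec_nonneg (hcom : S.GoodCommunication) (v : S.Ve → ℝ) :
    0 ≤ v ⬝ᵥ S.Lcom.mulVec v := by
  rw [dotProduct_Lcom_mulVec hcom]
  exact mul_nonneg (by norm_num) (Finset.sum_nonneg fun i _ => Finset.sum_nonneg fun j _ =>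
    mul_nonneg (hcom.nonneg i j) (sq_nonneg _))

theorem eq_of_dotProduct_Lcom_mulVec_eq_zero (hcom : S.GoodCommunication) {v : S.Ve → ℝ}
    (hv : v ⬝ᵥ S.Lcom.mulVec v = 0) (i j : S.Ve) : v i = v j := by
  have hnn : ∀ i j, 0 ≤ S.w i j * (v i - v j) ^ 2 := fun i j =>
    mul_nonneg (hcom.nonneg i j) (sq_nonneg _)
  rw [dotProduct_Lcom_mulVec hcom, mul_eq_zero] at hv
  have h1 := hv.resolve_left (by norm_num)
  rw [Finset.sum_eq_zero_iff_of_nonneg fun i _ => Finset.sum_nonneg fun j _ => hnn i j] at h1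
  have h2 : ∀ a b, 0 < S.w a b → v a = v b := by
    intro a b hab
    have h3 := h1 a (Finset.mem_univ a)
    rw [Finset.sum_eq_zero_iff_of_nonneg fun j _ => hnn a j] at h3
    have h4 := (mul_eq_zero.1 (h3 b (Finset.mem_univ b))).resolve_left hab.ne'
    exact sub_eq_zero.1 (pow_eq_zero_iff two_ne_zero |>.1 h4)
  induction hcom.strongly_connected i j with
  | refl => rfl
  | tail _ hab ih => rw [ih, h2 _ _ hab]

theorem Lcom_mulVec_eq_zero_of_const {v : S.Ve → ℝ} (hv : ∀ i j, v i = v j) :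
    S.Lcom.mulVec v = 0 := by
  funext i
  rw [Lcom_mulVec_apply, Pi.zero_apply]
  exact Finset.sum_eq_zero fun j _ => by rw [hv i j, sub_self, mul_zero]

end Laplacian

theorem Q_mulVec_apply (v : S.Ve → ℝ) (i : S.Ve) : S.Q.mulVec v i = S.q i * v i := by
  simp [Q, Matrix.mulVec_diagonal]

/-! ### The optimal input and its attainability -/

section Optimality

variable (S) in
theorem sum_Psi_sub_d (x : V → ℝ) : ∑ i, (S.Psi x - S.d) i = -∑ i, S.dHat x i := by
  simp only [Psi, dHat, Pi.sub_apply, Pi.add_apply, Pi.neg_apply, Finset.sum_sub_distrib,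
    Finset.sum_add_distrib, Finset.sum_neg_distrib, Bc, OrientedGraph.sum_incidence_mulVec]
  ring

theorem sum_eq_of_feasible {x : V → ℝ} {u : S.Ve → ℝ} {lam : ι → ℝ} (h : S.Feasible x u lam) :
    ∑ j, u j = ∑ i, S.dHat x i := by
  have h1 : ∑ i, (S.Psi x - S.B.mulVec lam + S.E.mulVec u - S.d) i = 0 := by
    rw [← show (0 : V → ℝ) = _ from h]; simp
  have h2 := S.sum_Psi_sub_d x
  simp only [Pi.sub_apply, Pi.add_apply, Finset.sum_sub_distrib, Finset.sum_add_distrib, B, E,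
    OrientedGraph.sum_incidence_mulVec, sum_selection_mulVec] at h1 h2
  linarith

theorem sum_inv_q_pos (hreg : S.Regular) (hinput : S.Ve.Nonempty) : 0 < ∑ j, 1 / S.q j := by
  have : Nonempty S.Ve := hinput.to_subtype
  exact Finset.sum_pos (fun j _ => one_div_pos.2 (hreg.q_pos j)) Finset.univ_nonempty

theorem kappaHat_mul (hreg : S.Regular) (hinput : S.Ve.Nonempty) (x : V → ℝ) :
    S.kappaHat x * ∑ j, 1 / S.q j = ∑ i, S.dHat x i + ∑ j, S.r j / S.q j := by
  rw [kappaHat, div_mul_cancel₀ _ (sum_inv_q_pos hreg hinput).ne']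
  simp only [Pi.add_apply, Finset.sum_add_distrib, E, sum_selection_mulVec]

theorem sum_sub_div (c : ℝ) :
    ∑ j, (c - S.r j) / S.q j = c * ∑ j, 1 / S.q j - ∑ j, S.r j / S.q j := by
  rw [Finset.mul_sum, ← Finset.sum_sub_distrib]
  exact Finset.sum_congr rfl fun j _ => by ring

theorem sum_uHat (hreg : S.Regular) (hinput : S.Ve.Nonempty) (x : V → ℝ) :
    ∑ j, S.uHat x j = ∑ i, S.dHat x i := by
  have := kappaHat_mul hreg hinput x
  simp only [uHat, sum_sub_div]
  linarith

/-- Inputs with equal marginal costs and the right total are equal to `û`. -/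
theorem eq_uHat_of_marginal (hreg : S.Regular) (hinput : S.Ve.Nonempty) {x : V → ℝ}
    {u : S.Ve → ℝ} (hsum : ∑ j, u j = ∑ i, S.dHat x i)
    (hu : ∀ i j, S.q i * u i + S.r i = S.q j * u j + S.r j) : u = S.uHat x := by
  obtain ⟨c, hc⟩ : ∃ c, ∀ j, u j = (c - S.r j) / S.q j := by
    obtain ⟨j₀, hj₀⟩ := hinput
    refine ⟨S.q ⟨j₀, hj₀⟩ * u ⟨j₀, hj₀⟩ + S.r ⟨j₀, hj₀⟩, fun j => ?_⟩
    rw [eq_div_iff (hreg.q_pos j).ne', hu _ j]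
    ring
  have h1 := kappaHat_mul hreg hinput x
  rw [Finset.sum_congr rfl fun j _ => hc j, sum_sub_div] at hsum
  have h2 : c = S.kappaHat x :=
    mul_right_cancel₀ (sum_inv_q_pos hreg hinput).ne' (by linarith)
  funext j
  rw [hc, h2, uHat]

theorem q_mul_uHat_add_r (hreg : S.Regular) (x : V → ℝ) (j : S.Ve) :
    S.q j * S.uHat x j + S.r j = S.kappaHat x := by
  rw [uHat, mul_div_cancel₀ _ (hreg.q_pos j).ne']
  ring

/-- Taylor expansion at `û`: the gradient there has all entries equal to `κ̂`, so the linear term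
only sees the difference of the totals, which is zero. -/
theorem cost_eq (hreg : S.Regular) (hinput : S.Ve.Nonempty) {x : V → ℝ} {u : S.Ve → ℝ}
    (hu : ∑ j, u j = ∑ i, S.dHat x i) :
    S.cost u = S.cost (S.uHat x) + ∑ j, 1 / 2 * S.q j * (u j - S.uHat x j) ^ 2 := by
  have h1 : ∑ j, S.kappaHat x * (u j - S.uHat x j) = 0 := by
    rw [← Finset.mul_sum, Finset.sum_sub_distrib, hu, sum_uHat hreg hinput, sub_self, mul_zero]
  rw [← add_zero (S.cost (S.uHat x) + _), ← h1]
  simp only [cost, ← Finset.sum_add_distrib]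
  refine Finset.sum_congr rfl fun j _ => ?_
  rw [← q_mul_uHat_add_r hreg x j]
  ring

theorem isOptimalInput_iff (hreg : S.Regular) (hinput : S.Ve.Nonempty) {x : V → ℝ}
    (hfeas : ∃ lam, S.Feasible x (S.uHat x) lam) (u : S.Ve → ℝ) :
    S.IsOptimalInput x u ↔ u = S.uHat x := by
  have hnn : ∀ (u : S.Ve → ℝ) (j), 0 ≤ 1 / 2 * S.q j * (u j - S.uHat x j) ^ 2 := fun u j =>
    mul_nonneg (mul_nonneg (by norm_num) (hreg.q_pos j).le) (sq_nonneg _)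
  constructor
  · rintro ⟨⟨lam, hlam⟩, hopt⟩
    obtain ⟨lam', hlam'⟩ := hfeas
    have h1 := hopt _ _ hlam'
    rw [cost_eq hreg hinput (sum_eq_of_feasible hlam)] at h1
    have h2 : ∑ j, 1 / 2 * S.q j * (u j - S.uHat x j) ^ 2 = 0 :=
      le_antisymm (by linarith) (Finset.sum_nonneg fun j _ => hnn u j)
    rw [Finset.sum_eq_zero_iff_of_nonneg fun j _ => hnn u j] at h2
    funext j
    have h3 := h2 j (Finset.mem_univ j)
    have h4 := hreg.q_pos j
    rw [mul_eq_zero] at h3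
    exact sub_eq_zero.1 (pow_eq_zero_iff two_ne_zero |>.1 (h3.resolve_left (by positivity)))
  · rintro rfl
    refine ⟨hfeas, fun u' lam' h' => ?_⟩
    rw [cost_eq hreg hinput (sum_eq_of_feasible h')]
    exact le_add_of_nonneg_right (Finset.sum_nonneg fun j _ => hnn u' j)

end Optimality

theorem exists_feasible_uHat (hreg : S.Regular) (hconn : S.net.graph.Connected)
    (hinput : S.Ve.Nonempty) {x : V → ℝ} (hatt : S.Attainable x) :
    ∃ lam, S.Feasible x (S.uHat x) lam ∧ ∀ k, lam k ∈ range (S.f k) := by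
  obtain ⟨⟨P, hP, om, hom⟩, -⟩ := hatt
  have hb : ∑ i, (S.Psi x + S.E.mulVec (S.uHat x) - S.d) i = 0 := by
    have h1 := S.sum_Psi_sub_d x
    have h2 := sum_uHat hreg hinput x
    simp only [Pi.sub_apply, Pi.add_apply, Finset.sum_sub_distrib, Finset.sum_add_distrib, E,
      sum_selection_mulVec] at h1 ⊢
    linarith
  refine ⟨_, ?_, hom⟩
  have h1 : S.B.mulVec (P.mulVec (S.Psi x + S.E.mulVec (S.uHat x) - S.d)) = _ :=
    S.net.incidence_mulVec_pinv_mulVec hconn hP hb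
  have h2 : S.B.mulVec (P.mulVec (S.B.mulVec om)) = S.B.mulVec om := by
    rw [Matrix.mulVec_mulVec, Matrix.mulVec_mulVec, show S.B * P * S.B = S.B from hP.1]
  rw [Feasible, Matrix.mulVec_add, Matrix.mulVec_sub S.B om, h1, h2]
  abel

/-! ### Description of the steady states -/

section Equilibria

theorem div_eq_zero_iff_of_pos {α : Type*} {T : α → ℝ} (hT : ∀ i, 0 < T i) (v : α → ℝ) :
    (fun i => v i / T i) = 0 ↔ v = 0 := by
  simp only [funext_iff, Pi.zero_apply]
  exact forall_congr' fun i => by simp [(hT i).ne']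

theorem isEquilibrium_iff (hreg : S.Regular) (z : S.State) :
    S.IsEquilibrium z ↔
      S.Feasible z.1 (mapVec S.g z.2.2.1) (mapVec S.f z.2.1) ∧
      S.B.transpose.mulVec (mapVec S.h z.1 - S.ybar) = 0 ∧
      -S.E.transpose.mulVec (mapVec S.h z.1 - S.ybar) - (mapVec S.g z.2.2.1 - z.2.2.2) = 0 ∧
      mapVec S.g z.2.2.1 - z.2.2.2
        - S.Q.mulVec (S.Lcom.mulVec (S.Q.mulVec z.2.2.2 + S.r)) = 0 := by
  obtain ⟨x, mu, th, ph⟩ := z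
  simp only [IsEquilibrium, field, Prod.mk_eq_zero, Feasible]
  exact and_congr ((div_eq_zero_iff_of_pos hreg.Tx_pos _).trans eq_comm)
    (and_congr (div_eq_zero_iff_of_pos hreg.Tmu_pos _)
      (and_congr (div_eq_zero_iff_of_pos hreg.Tth_pos _)
        (div_eq_zero_iff_of_pos hreg.Tph_pos _)))

theorem isEquilibrium_iff_eq (hreg : S.Regular) (hconn : S.net.graph.Connected)
    (hinput : S.Ve.Nonempty) {xbar : V → ℝ} (hxbar : ∀ i, S.h i (xbar i) = S.ybar i)
    (hcom : S.GoodCommunication) (z : S.State) :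
    S.IsEquilibrium z ↔ z.1 = xbar ∧ mapVec S.g z.2.2.1 = S.uHat xbar ∧ z.2.2.2 = S.uHat xbar ∧
      S.Feasible xbar (S.uHat xbar) (mapVec S.f z.2.1) := by
  have hybar : mapVec S.h xbar - S.ybar = 0 := by
    funext i; simp [mapVec, hxbar]
  rw [isEquilibrium_iff hreg]
  obtain ⟨x, mu, th, ph⟩ := z
  dsimp only
  constructor
  · rintro ⟨h1, h2, h3, h4⟩
    have hc := S.net.eq_of_transpose_incidence_mulVec_eq_zero hconn h2
    obtain ⟨j₀, hj₀⟩ := hinput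
    -- Connectedness makes the output error a constant `c` over all nodes. The controller equations
    -- turn it into a Laplacian value `-c / q`, and the zero sum of Laplacian values gives `c = 0`.
    set c := (mapVec S.h x - S.ybar) j₀ with hcdef
    have h5 : ∀ j, mapVec S.g th j - ph j = -c := by
      intro j
      have h6 := congrFun h3 j
      simp only [E, Pi.sub_apply, Pi.neg_apply, transpose_selection_mulVec_apply,
        Pi.zero_apply] at h6
      have h7 := hc j j₀
      simp only [Pi.sub_apply] at h7 hcdef
      linarith
    have h8 : ∀ j, S.Lcom.mulVec (S.Q.mulVec ph + S.r) j = -c * (1 / S.q j) := by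
      intro j
      have h6 := congrFun h4 j
      simp only [Pi.sub_apply, Q_mulVec_apply, Pi.zero_apply] at h6
      rw [h5] at h6
      have := (hreg.q_pos j).ne'
      field_simp
      linarith
    have hc0 : c = 0 := by
      have h9 := sum_Lcom_mulVec hcom (S.Q.mulVec ph + S.r)
      rw [Finset.sum_congr rfl fun j _ => h8 j, ← Finset.mul_sum, mul_eq_zero] at h9
      simpa using h9.resolve_right (sum_inv_q_pos hreg ⟨j₀, hj₀⟩).ne'
    have hx : x = xbar := by
      funext i
      have h6 := hc i j₀
      rw [← hcdef, hc0, Pi.sub_apply, ← hxbar, sub_eq_zero] at h6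
      exact (hreg.h_strictMono i).injective h6
    have hL : S.Lcom.mulVec (S.Q.mulVec ph + S.r) = 0 := by
      funext j; rw [h8, hc0]; simp
    have hgp : mapVec S.g th = ph := by
      funext j; have := h5 j; rw [hc0] at this; linarith
    subst hx
    have hph : ph = S.uHat x := by
      refine eq_uHat_of_marginal hreg ⟨j₀, hj₀⟩ (hgp ▸ sum_eq_of_feasible h1) fun i j => ?_
      have := eq_of_dotProduct_Lcom_mulVec_eq_zero hcom
        (v := S.Q.mulVec ph + S.r) (by rw [hL, dotProduct_zero]) i j
      simpa only [Pi.add_apply, Q_mulVec_apply] using this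
    rw [hgp, hph] at h1
    exact ⟨rfl, hgp.trans hph, hph, h1⟩
  · rintro ⟨rfl, hg, rfl, hf⟩
    have hL : S.Lcom.mulVec (S.Q.mulVec (S.uHat x) + S.r) = 0 :=
      Lcom_mulVec_eq_zero_of_const fun i j => by
        simp only [Pi.add_apply, Q_mulVec_apply, q_mul_uHat_add_r hreg]
    rw [hg, hybar, hL]
    refine ⟨hf, ?_, ?_, ?_⟩ <;> simp

end Equilibria

end FlowSystem

theorem transpose_mulVec_dotProduct {α β : Type*} [Fintype α] [Fintype β] (M : Matrix α β ℝ)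
    (a : α → ℝ) (c : β → ℝ) : M.transpose.mulVec a ⬝ᵥ c = a ⬝ᵥ M.mulVec c := by
  rw [Matrix.dotProduct_mulVec, Matrix.mulVec_transpose]

/-! ### Scalar and smoothness tools -/

section Monotone

variable {α : Type*} [Fintype α] {F : α → ℝ → ℝ}

theorem sub_mul_sub_nonneg_of_monotone {F : ℝ → ℝ} (hF : Monotone F) (a b : ℝ) :
    0 ≤ (a - b) * (F a - F b) := by
  rcases le_total a b with h | h
  · exact mul_nonneg_of_nonpos_of_nonpos (sub_nonpos.2 h) (sub_nonpos.2 (hF h))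
  · exact mul_nonneg (sub_nonneg.2 h) (sub_nonneg.2 (hF h))

theorem dotProduct_mapVec_sub_nonneg (hF : ∀ i, Monotone (F i)) (a b : α → ℝ) :
    0 ≤ (a - b) ⬝ᵥ (mapVec F a - mapVec F b) :=
  Finset.sum_nonneg fun i _ => sub_mul_sub_nonneg_of_monotone (hF i) (a i) (b i)

theorem mapVec_eq_of_dotProduct_eq_zero (hF : ∀ i, Monotone (F i)) {a b : α → ℝ}
    (h : (a - b) ⬝ᵥ (mapVec F a - mapVec F b) = 0) : mapVec F a = mapVec F b := by
  have h1 := (Finset.sum_eq_zero_iff_of_nonneg fun i _ =>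
    sub_mul_sub_nonneg_of_monotone (hF i) (a i) (b i)).1 h
  funext i
  rcases mul_eq_zero.1 (h1 i (Finset.mem_univ i)) with h2 | h2
  · simp only [mapVec, sub_eq_zero.1 h2]
  · exact sub_eq_zero.1 h2

/-- Otherwise monotonicity would make `F` constant between `a` and `b`, with zero one-sided
derivative at `a`. -/
theorem eq_of_deriv_pos_of_monotone {F : ℝ → ℝ} (hF : Monotone F) {a b : ℝ}
    (ha : 0 < deriv F a) (hab : F b = F a) : b = a := by
  have hd := (differentiableAt_of_deriv_ne_zero ha.ne').hasDerivAt
  by_contra hne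
  have hsub : EqOn F (fun _ => F a) (uIcc a b) := by
    intro c hc
    rcases le_total a b with h | h
    · rw [uIcc_of_le h] at hc
      exact le_antisymm ((hF hc.2).trans hab.le) (hF hc.1)
    · rw [uIcc_of_ge h] at hc
      exact le_antisymm (hF hc.2) (hab.symm.le.trans (hF hc.1))
  have h0 : HasDerivWithinAt F 0 (uIcc a b) a :=
    (hasDerivWithinAt_const a _ (F a)).congr hsub rfl
  have hu : UniqueDiffWithinAt ℝ (uIcc a b) a :=
    uniqueDiffOn_Icc (inf_lt_sup.2 (Ne.symm hne)) a left_mem_uIcc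
  exact ha.ne' (hu.eq_deriv _ hd.hasDerivWithinAt h0)

end Monotone

section Constancy

theorem eq_initial_of_hasDerivWithinAt_zero {u : ℝ → ℝ}
    (hu : ∀ t, 0 ≤ t → HasDerivWithinAt u 0 (Ici 0) t) {t : ℝ} (ht : 0 ≤ t) : u t = u 0 :=
  constant_of_has_deriv_right_zero
    (fun s hs => ((hu s hs.1).continuousWithinAt).mono Icc_subset_Ici_self)
    (fun s hs => (hu s hs.1).mono (Ici_subset_Ici.2 hs.1)) t ⟨ht, le_rfl⟩

theorem eq_zero_of_hasDerivWithinAt_of_const {u : ℝ → ℝ} {u' c t : ℝ} (ht : 0 ≤ t)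
    (hu : HasDerivWithinAt u u' (Ici 0) t) (hc : ∀ t, 0 ≤ t → u t = c) : u' = 0 :=
  (uniqueDiffOn_Ici (0 : ℝ) t ht).eq_deriv _ hu
    ((hasDerivWithinAt_const t _ c).congr (fun s hs => hc s hs) (hc t ht))

end Constancy

section Smoothness

variable {X : Type*} [NormedAddCommGroup X] [NormedSpace ℝ X] {α β : Type*} [Fintype α]
  [Fintype β] {n : WithTop ℕ∞}

theorem ContDiff.matrix_mulVec (M : Matrix α β ℝ) {v : X → β → ℝ} (hv : ContDiff ℝ n v) :
    ContDiff ℝ n fun x => M.mulVec (v x) :=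
  (LinearMap.toContinuousLinearMap (Matrix.mulVecLin M)).contDiff.comp hv

theorem ContDiff.mapVec {F : α → ℝ → ℝ} (hF : ∀ i, ContDiff ℝ n (F i)) {v : X → α → ℝ}
    (hv : ContDiff ℝ n v) : ContDiff ℝ n fun x => mapVec F (v x) :=
  contDiff_pi.2 fun i => (hF i).comp (contDiff_pi.1 hv i)

end Smoothness

namespace OrientedGraph

variable {V ι : Type*} [Fintype V] [Fintype ι] [DecidableEq V] (G : OrientedGraph V ι)

theorem incidence_pos (k : ι) : G.incidence (G.pos k) k = 1 := by simp [incidence]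

theorem incidence_neg (k : ι) : G.incidence (G.neg k) k = -1 := by
  simp [incidence, (G.ne k).symm]

theorem transpose_incidence_of_pos {v : V → ℝ} {k : ι} (hv : v (G.pos k) = 0) :
    G.incidence.transpose.mulVec v k = -G.incidence (G.pos k) k * v (G.neg k) := by
  rw [transpose_incidence_mulVec_apply, hv, incidence_pos]; ring

theorem transpose_incidence_of_neg {v : V → ℝ} {k : ι} (hv : v (G.neg k) = 0) :
    G.incidence.transpose.mulVec v k = -G.incidence (G.neg k) k * v (G.pos k) := by
  rw [transpose_incidence_mulVec_apply, hv, incidence_neg]; ring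

theorem exists_edge_of_adj {i j : V} (h : G.graph.Adj i j) :
    ∃ k, (G.incidence i k = 1 ∨ G.incidence i k = -1) ∧ ∀ v : V → ℝ, v i = 0 →
      G.incidence.transpose.mulVec v k = -G.incidence i k * v j := by
  obtain ⟨k, ⟨rfl, rfl⟩ | ⟨rfl, rfl⟩⟩ := h
  · exact ⟨k, Or.inl (G.incidence_pos k), fun v hv => G.transpose_incidence_of_pos hv⟩
  · exact ⟨k, Or.inr (G.incidence_neg k), fun v hv => G.transpose_incidence_of_neg hv⟩

/-- Covers every edge at `i`, parallel ones included, with one formula for both orientations. -/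
theorem exists_adj_of_incidence_ne_zero {i : V} {k : ι} (h : G.incidence i k ≠ 0) :
    ∃ l, G.graph.Adj i l ∧ (G.incidence i k = 1 ∨ G.incidence i k = -1) ∧ ∀ v : V → ℝ, v i = 0 →
      G.incidence.transpose.mulVec v k = -G.incidence i k * v l := by
  by_cases h1 : i = G.pos k
  · subst h1
    exact ⟨G.neg k, ⟨k, Or.inl ⟨rfl, rfl⟩⟩, Or.inl (G.incidence_pos k),
      fun v hv => G.transpose_incidence_of_pos hv⟩
  by_cases h2 : i = G.neg k
  · subst h2
    exact ⟨G.pos k, ⟨k, Or.inr ⟨rfl, rfl⟩⟩, Or.inr (G.incidence_neg k),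
      fun v hv => G.transpose_incidence_of_neg hv⟩
  · exact absurd (by simp [incidence, h1, h2]) h

end OrientedGraph

namespace FlowSystem

variable {V ι κ : Type*} [Fintype V] [Fintype ι] [Fintype κ] [DecidableEq V]
  {S : FlowSystem V ι κ}

theorem contDiff_Psi (hreg : S.Regular) {X : Type*} [NormedAddCommGroup X] [NormedSpace ℝ X]
    {v : X → V → ℝ} (hv : ContDiff ℝ 1 v) : ContDiff ℝ 1 fun x => S.Psi (v x) := by
  have hh := ContDiff.mapVec hreg.h_contDiff hv
  exact ((ContDiff.mapVec hreg.gam_contDiff (hh.matrix_mulVec _)).matrix_mulVec _).neg.sub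
    ((ContDiff.mapVec hreg.eta_contDiff (hh.matrix_mulVec _)).matrix_mulVec _)

theorem contDiff_field (hreg : S.Regular) (hout : S.GoodOutputs) : ContDiff ℝ 1 S.field := by
  have hx : ContDiff ℝ 1 fun z : S.State => z.1 := contDiff_fst
  have hmu : ContDiff ℝ 1 fun z : S.State => z.2.1 := contDiff_fst.comp contDiff_snd
  have hth : ContDiff ℝ 1 fun z : S.State => z.2.2.1 :=
    contDiff_fst.comp (contDiff_snd.comp contDiff_snd)
  have hph : ContDiff ℝ 1 fun z : S.State => z.2.2.2 :=
    contDiff_snd.comp (contDiff_snd.comp contDiff_snd)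
  have hh := (ContDiff.mapVec hreg.h_contDiff hx).sub (contDiff_const (c := S.ybar))
  have hf := ContDiff.mapVec hout.f_contDiff hmu
  have hg := ContDiff.mapVec hout.g_contDiff hth
  have h1 := (((contDiff_Psi hreg hx).sub (hf.matrix_mulVec S.B)).add
    (hg.matrix_mulVec S.E)).sub (contDiff_const (c := S.d))
  have h2 := hh.matrix_mulVec S.B.transpose
  have h3 := (hh.matrix_mulVec S.E.transpose).neg.sub (hg.sub hph)
  have h4 := (hg.sub hph).sub ((((hph.matrix_mulVec S.Q).add
    (contDiff_const (c := S.r))).matrix_mulVec S.Lcom).matrix_mulVec S.Q)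
  exact (contDiff_pi.2 fun i => (contDiff_pi.1 h1 i).div_const _).prodMk
    ((contDiff_pi.2 fun k => (contDiff_pi.1 h2 k).div_const _).prodMk
      ((contDiff_pi.2 fun i => (contDiff_pi.1 h3 i).div_const _).prodMk
        (contDiff_pi.2 fun i => (contDiff_pi.1 h4 i).div_const _)))

/-! ### The storage function and its dissipation -/

section Storage

variable (S)

/-- The storage function of the closed loop system with respect to the state `p`. -/
noncomputable def storage (p z : S.State) : ℝ :=
  potentialSum S.Tx S.h p.1 z.1 + (potentialSum S.Tmu S.f p.2.1 z.2.1 +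
    (potentialSum S.Tth S.g p.2.2.1 z.2.2.1 +
      potentialSum S.Tph (fun _ => id) p.2.2.2 z.2.2.2))

/-- The derivative of the storage function. -/
noncomputable def storageDeriv (p z : S.State) : S.State →L[ℝ] ℝ :=
  (potentialSumDeriv S.Tx S.h p.1 z.1).comp (.fst ℝ _ _) +
    ((potentialSumDeriv S.Tmu S.f p.2.1 z.2.1).comp ((ContinuousLinearMap.fst ℝ _ _).comp
        (.snd ℝ _ _)) +
      ((potentialSumDeriv S.Tth S.g p.2.2.1 z.2.2.1).comp ((ContinuousLinearMap.fst ℝ _ _).comp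
          ((ContinuousLinearMap.snd ℝ _ _).comp (.snd ℝ _ _))) +
        (potentialSumDeriv S.Tph (fun _ => id) p.2.2.2 z.2.2.2).comp
          ((ContinuousLinearMap.snd ℝ _ _).comp
            ((ContinuousLinearMap.snd ℝ _ _).comp (.snd ℝ _ _)))))

variable {S}

theorem hasFDerivAt_storage (hreg : S.Regular) (hout : S.GoodOutputs) (p z : S.State) :
    HasFDerivAt (S.storage p) (S.storageDeriv p z) z := by
  have h1 := (hasFDerivAt_potentialSum (T := S.Tx) (fun i => (hreg.h_contDiff i).continuous)
    p.1 z.1).comp z (hasFDerivAt_fst (𝕜 := ℝ))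
  have e2 : HasFDerivAt (fun z : S.State => z.2.1)
      ((ContinuousLinearMap.fst ℝ _ _).comp (.snd ℝ _ _)) z :=
    hasFDerivAt_fst.comp z hasFDerivAt_snd
  have e3 : HasFDerivAt (fun z : S.State => z.2.2.1) ((ContinuousLinearMap.fst ℝ _ _).comp
      ((ContinuousLinearMap.snd ℝ _ _).comp (.snd ℝ _ _))) z :=
    hasFDerivAt_fst.comp z (hasFDerivAt_snd.comp z hasFDerivAt_snd)
  have e4 : HasFDerivAt (fun z : S.State => z.2.2.2) ((ContinuousLinearMap.snd ℝ _ _).comp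
      ((ContinuousLinearMap.snd ℝ _ _).comp (.snd ℝ _ _))) z :=
    hasFDerivAt_snd.comp z (hasFDerivAt_snd.comp z hasFDerivAt_snd)
  have h2 := (hasFDerivAt_potentialSum (T := S.Tmu) (fun i => (hout.f_contDiff i).continuous)
    p.2.1 z.2.1).comp z e2
  have h3 := (hasFDerivAt_potentialSum (T := S.Tth) (fun i => (hout.g_contDiff i).continuous)
    p.2.2.1 z.2.2.1).comp z e3
  have h4 := (hasFDerivAt_potentialSum (T := S.Tph) (F := fun _ => id) (fun i => continuous_id)
    p.2.2.2 z.2.2.2).comp z e4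
  exact h1.add (h2.add (h3.add h4))

theorem dotProduct_Psi_sub (x y : V → ℝ) :
    (mapVec S.h x - mapVec S.h y) ⬝ᵥ (S.Psi x - S.Psi y) =
      -((S.Bc.transpose.mulVec (mapVec S.h x) - S.Bc.transpose.mulVec (mapVec S.h y)) ⬝ᵥ
        (mapVec S.gam (S.Bc.transpose.mulVec (mapVec S.h x)) -
          mapVec S.gam (S.Bc.transpose.mulVec (mapVec S.h y)))) -
      (S.Ec.transpose.mulVec (mapVec S.h x) - S.Ec.transpose.mulVec (mapVec S.h y)) ⬝ᵥ
        (mapVec S.eta (S.Ec.transpose.mulVec (mapVec S.h x)) -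
          mapVec S.eta (S.Ec.transpose.mulVec (mapVec S.h y))) := by
  rw [← Matrix.mulVec_sub, ← Matrix.mulVec_sub, transpose_mulVec_dotProduct,
    transpose_mulVec_dotProduct, Matrix.mulVec_sub, Matrix.mulVec_sub,
    ← dotProduct_neg, ← dotProduct_sub]
  congr 1
  simp only [Psi]
  abel

/-- The derivative of the storage function along the closed loop system. -/
theorem storageDeriv_field (hreg : S.Regular) {xbar : V → ℝ}
    (hxbar : ∀ i, S.h i (xbar i) = S.ybar i) {p : S.State} (h1 : p.1 = xbar)
    (h2 : mapVec S.g p.2.2.1 = S.uHat xbar) (h3 : p.2.2.2 = S.uHat xbar)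
    (h4 : S.Feasible xbar (S.uHat xbar) (mapVec S.f p.2.1)) (z : S.State) :
    S.storageDeriv p z (S.field z) =
      (mapVec S.h z.1 - mapVec S.h xbar) ⬝ᵥ (S.Psi z.1 - S.Psi xbar)
      - (mapVec S.g z.2.2.1 - z.2.2.2) ⬝ᵥ (mapVec S.g z.2.2.1 - z.2.2.2)
      - S.Q.mulVec (z.2.2.2 - S.uHat xbar) ⬝ᵥ
        S.Lcom.mulVec (S.Q.mulVec (z.2.2.2 - S.uHat xbar)) := by
  obtain ⟨x, mu, th, ph⟩ := z
  obtain ⟨px, pmu, pth, pph⟩ := p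
  dsimp only at h1 h2 h3 h4
  subst h1 h3
  have hybar : S.ybar = mapVec S.h px := by funext i; simp [mapVec, hxbar]
  have hid : ∀ v : S.Ve → ℝ, mapVec (fun _ => id) v = v := fun v => rfl
  have hL : S.Lcom.mulVec (S.Q.mulVec ph + S.r) =
      S.Lcom.mulVec (S.Q.mulVec (ph - S.uHat px)) := by
    have : S.Q.mulVec ph + S.r =
        S.Q.mulVec (ph - S.uHat px) + (S.Q.mulVec (S.uHat px) + S.r) := by
      rw [Matrix.mulVec_sub]; abel
    rw [this, Matrix.mulVec_add S.Lcom, Lcom_mulVec_eq_zero_of_const (v := _ + S.r) fun i j => by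
      simp only [Pi.add_apply, Q_mulVec_apply, q_mul_uHat_add_r hreg], add_zero]
  have hfe : S.Psi x - S.B.mulVec (mapVec S.f mu) + S.E.mulVec (mapVec S.g th) - S.d =
      (S.Psi x - S.Psi px) - S.B.mulVec (mapVec S.f mu - mapVec S.f pmu)
        + S.E.mulVec (mapVec S.g th - S.uHat px) := by
    have h5 : S.Psi px = S.B.mulVec (mapVec S.f pmu) - S.E.mulVec (S.uHat px) + S.d := by
      have h6 : (0 : V → ℝ) = _ := h4
      rw [← sub_eq_zero, ← neg_eq_zero, ← neg_zero, h6]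
      abel
    rw [h5, Matrix.mulVec_sub, Matrix.mulVec_sub]
    abel
  have hQ : ∀ a b : S.Ve → ℝ, a ⬝ᵥ S.Q.mulVec b = S.Q.mulVec a ⬝ᵥ b := by
    intro a b
    simp only [dotProduct, Q_mulVec_apply]
    exact Finset.sum_congr rfl fun j _ => by ring
  have hB : ∀ (a : V → ℝ) l, a ⬝ᵥ S.B.mulVec l = l ⬝ᵥ S.B.transpose.mulVec a := by
    intro a l
    rw [← transpose_mulVec_dotProduct, dotProduct_comm]
  have hE : ∀ (a : V → ℝ) u, a ⬝ᵥ S.E.mulVec u = u ⬝ᵥ S.E.transpose.mulVec a := by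
    intro a l
    rw [← transpose_mulVec_dotProduct, dotProduct_comm]
  -- Written this way, the cross terms of the `θ` and `φ` equations combine to minus the square of
  -- `g(θ) - φ`.
  have hsplit : mapVec S.g th - ph = (mapVec S.g th - S.uHat px) - (ph - S.uHat px) := by abel
  simp only [storageDeriv, field, add_apply, ContinuousLinearMap.comp_apply,
    ContinuousLinearMap.coe_fst', ContinuousLinearMap.coe_snd']
  rw [potentialSumDeriv_apply_div hreg.Tx_pos, potentialSumDeriv_apply_div hreg.Tmu_pos,
    potentialSumDeriv_apply_div hreg.Tth_pos, potentialSumDeriv_apply_div hreg.Tph_pos, hfe, hL,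
    hid, hid, hybar, h2, hsplit]
  simp only [dotProduct_add, dotProduct_sub _ (_ - _) _, hB, hE, hQ]
  simp only [sub_dotProduct, dotProduct_sub, dotProduct_neg]
  ring

theorem isLyapunov_storage (hreg : S.Regular) (hout : S.GoodOutputs) (hcom : S.GoodCommunication)
    {xbar : V → ℝ} (hxbar : ∀ i, S.h i (xbar i) = S.ybar i) {p : S.State} (h1 : p.1 = xbar)
    (h2 : mapVec S.g p.2.2.1 = S.uHat xbar) (h3 : p.2.2.2 = S.uHat xbar)
    (h4 : S.Feasible xbar (S.uHat xbar) (mapVec S.f p.2.1)) :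
    IsLyapunov S.field (S.storage p) (S.storageDeriv p) where
  hasFDerivAt := hasFDerivAt_storage hreg hout p
  nonpos z := by
    rw [storageDeriv_field hreg hxbar h1 h2 h3 h4, dotProduct_Psi_sub]
    have e1 := dotProduct_mapVec_sub_nonneg hreg.gam_mono
      (S.Bc.transpose.mulVec (mapVec S.h z.1)) (S.Bc.transpose.mulVec (mapVec S.h xbar))
    have e2 := dotProduct_mapVec_sub_nonneg hreg.eta_mono
      (S.Ec.transpose.mulVec (mapVec S.h z.1)) (S.Ec.transpose.mulVec (mapVec S.h xbar))
    have e3 := dotProduct_Lcom_mulVec_nonneg hcom (S.Q.mulVec (z.2.2.2 - S.uHat xbar))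
    have e4 : 0 ≤ (mapVec S.g z.2.2.1 - z.2.2.2) ⬝ᵥ (mapVec S.g z.2.2.1 - z.2.2.2) :=
      Finset.sum_nonneg fun i _ => mul_self_nonneg _
    linarith
  bounded c := by
    have hh : ∀ i, Continuous (S.h i) := fun i => (hreg.h_contDiff i).continuous
    have hf : ∀ i, Continuous (S.f i) := fun i => (hout.f_contDiff i).continuous
    have hg : ∀ i, Continuous (S.g i) := fun i => (hout.g_contDiff i).continuous
    refine ((isBounded_potentialSum_le hreg.Tx_pos hh hreg.h_strictMono p.1 c).prod
      ((isBounded_potentialSum_le hreg.Tmu_pos hf hout.f_strictMono p.2.1 c).prod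
        ((isBounded_potentialSum_le hreg.Tth_pos hg hout.g_strictMono p.2.2.1 c).prod
          (isBounded_potentialSum_le hreg.Tph_pos (F := fun _ => id) (fun _ => continuous_id)
            (fun _ => strictMono_id) p.2.2.2 c)))).subset fun z hz => ?_
    have e1 := potentialSum_nonneg hreg.Tx_pos hh hreg.h_strictMono p.1 z.1
    have e2 := potentialSum_nonneg hreg.Tmu_pos hf hout.f_strictMono p.2.1 z.2.1
    have e3 := potentialSum_nonneg hreg.Tth_pos hg hout.g_strictMono p.2.2.1 z.2.2.1
    have e4 := potentialSum_nonneg hreg.Tph_pos (F := fun _ => id) (fun _ => continuous_id)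
      (fun _ => strictMono_id) p.2.2.2 z.2.2.2
    simp only [storage, mem_ofPred_eq] at hz
    refine ⟨?_, ?_, ?_, ?_⟩ <;> simp only [mem_ofPred_eq] <;> linarith

theorem eq_of_storage_le (hreg : S.Regular) (hout : S.GoodOutputs) {p z : S.State}
    (h : S.storage p z ≤ S.storage p p) : z = p := by
  have hh : ∀ i, Continuous (S.h i) := fun i => (hreg.h_contDiff i).continuous
  have hf : ∀ i, Continuous (S.f i) := fun i => (hout.f_contDiff i).continuous
  have hg : ∀ i, Continuous (S.g i) := fun i => (hout.g_contDiff i).continuous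
  have e1 := potentialSum_nonneg hreg.Tx_pos hh hreg.h_strictMono p.1 z.1
  have e2 := potentialSum_nonneg hreg.Tmu_pos hf hout.f_strictMono p.2.1 z.2.1
  have e3 := potentialSum_nonneg hreg.Tth_pos hg hout.g_strictMono p.2.2.1 z.2.2.1
  have e4 := potentialSum_nonneg hreg.Tph_pos (F := fun _ => id) (fun _ => continuous_id)
    (fun _ => strictMono_id) p.2.2.2 z.2.2.2
  simp only [storage, potentialSum_self, add_zero] at h
  refine Prod.ext ?_ (Prod.ext ?_ (Prod.ext ?_ ?_))
  · exact eq_of_potentialSum_nonpos hreg.Tx_pos hh hreg.h_strictMono (by linarith)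
  · exact eq_of_potentialSum_nonpos hreg.Tmu_pos hf hout.f_strictMono (by linarith)
  · exact eq_of_potentialSum_nonpos hreg.Tth_pos hg hout.g_strictMono (by linarith)
  · exact eq_of_potentialSum_nonpos hreg.Tph_pos (F := fun _ => id) (fun _ => continuous_id)
      (fun _ => strictMono_id) (by linarith)

end Storage

end FlowSystem

namespace FlowSystem

variable {V ι κ : Type*} [Fintype V] [Fintype ι] [Fintype κ] [DecidableEq V]
  {S : FlowSystem V ι κ}

/-- Both monotone forms vanish, so the values of `γ` and `η` agree at `x` and `y`; where `η` has
positive derivative, its argument must agree too. -/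
theorem Psi_eq_of_dotProduct_eq_zero (hreg : S.Regular) {x y : V → ℝ}
    (h : (mapVec S.h x - mapVec S.h y) ⬝ᵥ (S.Psi x - S.Psi y) = 0) :
    S.Psi x = S.Psi y ∧ ∀ i ∈ S.Vs y, x i = y i := by
  rw [dotProduct_Psi_sub] at h
  have e1 := dotProduct_mapVec_sub_nonneg hreg.gam_mono
    (S.Bc.transpose.mulVec (mapVec S.h x)) (S.Bc.transpose.mulVec (mapVec S.h y))
  have e2 := dotProduct_mapVec_sub_nonneg hreg.eta_mono
    (S.Ec.transpose.mulVec (mapVec S.h x)) (S.Ec.transpose.mulVec (mapVec S.h y))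
  have e3 := mapVec_eq_of_dotProduct_eq_zero hreg.gam_mono (le_antisymm (by linarith) e1)
  have e4 := mapVec_eq_of_dotProduct_eq_zero hreg.eta_mono (le_antisymm (by linarith) e2)
  refine ⟨by rw [Psi, Psi, e3, e4], ?_⟩
  rintro i ⟨hi, hd⟩
  have e5 := eq_of_deriv_pos_of_monotone (hreg.eta_mono ⟨i, hi⟩) hd (congrFun e4 ⟨i, hi⟩)
  simp only [Ec, transpose_selection_mulVec_apply] at e5
  exact (hreg.h_strictMono i).injective e5

theorem storageDeriv_eq_zero (hreg : S.Regular) (hcom : S.GoodCommunication)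
    {xbar : V → ℝ} (hxbar : ∀ i, S.h i (xbar i) = S.ybar i) {p : S.State} (h1 : p.1 = xbar)
    (h2 : mapVec S.g p.2.2.1 = S.uHat xbar) (h3 : p.2.2.2 = S.uHat xbar)
    (h4 : S.Feasible xbar (S.uHat xbar) (mapVec S.f p.2.1)) {z : S.State}
    (hz : S.storageDeriv p z (S.field z) = 0) :
    S.Psi z.1 = S.Psi xbar ∧ (∀ i ∈ S.Vs xbar, z.1 i = xbar i) ∧
      mapVec S.g z.2.2.1 = z.2.2.2 ∧ S.Lcom.mulVec (S.Q.mulVec z.2.2.2 + S.r) = 0 := by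
  rw [storageDeriv_field hreg hxbar h1 h2 h3 h4] at hz
  have e1 : (mapVec S.h z.1 - mapVec S.h xbar) ⬝ᵥ (S.Psi z.1 - S.Psi xbar) ≤ 0 := by
    rw [dotProduct_Psi_sub]
    have e1 := dotProduct_mapVec_sub_nonneg hreg.gam_mono
      (S.Bc.transpose.mulVec (mapVec S.h z.1)) (S.Bc.transpose.mulVec (mapVec S.h xbar))
    have e2 := dotProduct_mapVec_sub_nonneg hreg.eta_mono
      (S.Ec.transpose.mulVec (mapVec S.h z.1)) (S.Ec.transpose.mulVec (mapVec S.h xbar))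
    linarith
  have e3 := dotProduct_Lcom_mulVec_nonneg hcom (S.Q.mulVec (z.2.2.2 - S.uHat xbar))
  have e4 : 0 ≤ (mapVec S.g z.2.2.1 - z.2.2.2) ⬝ᵥ (mapVec S.g z.2.2.1 - z.2.2.2) :=
    Finset.sum_nonneg fun i _ => mul_self_nonneg _
  obtain ⟨h5, h6⟩ := Psi_eq_of_dotProduct_eq_zero hreg (le_antisymm e1 (by linarith))
  refine ⟨h5, h6, sub_eq_zero.1 (dotProduct_self_eq_zero.1 (le_antisymm (by linarith) e4)), ?_⟩
  have e5 := eq_of_dotProduct_Lcom_mulVec_eq_zero hcom (le_antisymm (by linarith) e3)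
  refine Lcom_mulVec_eq_zero_of_const fun i j => ?_
  have e6 := e5 i j
  have e7 := q_mul_uHat_add_r hreg xbar i
  have e8 := q_mul_uHat_add_r hreg xbar j
  simp only [Q_mulVec_apply, Pi.sub_apply, Pi.add_apply] at e6 ⊢
  linarith

/-! ### Zero forcing along solutions without dissipation -/

section Forcing

variable {y : ℝ → S.State}

theorem hasDerivWithinAt_x (hy : SolvesODE S.field y) (i : V) {t : ℝ} (ht : 0 ≤ t) :
    HasDerivWithinAt (fun s => (y s).1 i) ((S.field (y t)).1 i) (Ici 0) t :=
  hasDerivWithinAt_pi.1 (hasFDerivAt_fst.comp_hasDerivWithinAt t (hy t ht)) i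

theorem hasDerivWithinAt_mu (hy : SolvesODE S.field y) (k : ι) {t : ℝ} (ht : 0 ≤ t) :
    HasDerivWithinAt (fun s => (y s).2.1 k) ((S.field (y t)).2.1 k) (Ici 0) t :=
  hasDerivWithinAt_pi.1 ((hasFDerivAt_fst.comp (y t) hasFDerivAt_snd).comp_hasDerivWithinAt t
    (hy t ht)) k

theorem hasDerivWithinAt_th (hy : SolvesODE S.field y) (i : S.Ve) {t : ℝ} (ht : 0 ≤ t) :
    HasDerivWithinAt (fun s => (y s).2.2.1 i) ((S.field (y t)).2.2.1 i) (Ici 0) t :=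
  hasDerivWithinAt_pi.1 ((hasFDerivAt_fst.comp (y t) (hasFDerivAt_snd.comp (y t)
    hasFDerivAt_snd)).comp_hasDerivWithinAt t (hy t ht)) i

theorem hasDerivWithinAt_ph (hy : SolvesODE S.field y) (i : S.Ve) {t : ℝ} (ht : 0 ≤ t) :
    HasDerivWithinAt (fun s => (y s).2.2.2 i) ((S.field (y t)).2.2.2 i) (Ici 0) t :=
  hasDerivWithinAt_pi.1 ((hasFDerivAt_snd.comp (y t) (hasFDerivAt_snd.comp (y t)
    hasFDerivAt_snd)).comp_hasDerivWithinAt t (hy t ht)) i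

/-- At a node at rest the mass balance has zero left side, and every term other than the net outflow
is constant in time. -/
theorem net_outflow_const (hreg : S.Regular) (hy : SolvesODE S.field y) {xbar : V → ℝ}
    (hPsi : ∀ t, 0 ≤ t → S.Psi (y t).1 = S.Psi xbar)
    (hu : ∀ t, 0 ≤ t → mapVec S.g (y t).2.2.1 = mapVec S.g (y 0).2.2.1) {i : V}
    (hi : ∀ t, 0 ≤ t → (y t).1 i = xbar i) {t : ℝ} (ht : 0 ≤ t) :
    S.B.mulVec (mapVec S.f (y t).2.1) i = S.B.mulVec (mapVec S.f (y 0).2.1) i := by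
  have key : ∀ s, 0 ≤ s → S.Psi xbar i - S.B.mulVec (mapVec S.f (y s).2.1) i
      + S.E.mulVec (mapVec S.g (y 0).2.2.1) i - S.d i = 0 := by
    intro s hs
    have h1 := eq_zero_of_hasDerivWithinAt_of_const hs (hasDerivWithinAt_x hy i hs) hi
    have h2 : (S.Psi (y s).1 - S.B.mulVec (mapVec S.f (y s).2.1)
        + S.E.mulVec (mapVec S.g (y s).2.2.1) - S.d) i / S.Tx i = 0 := h1
    rw [div_eq_zero_iff, or_iff_left (hreg.Tx_pos i).ne', hPsi s hs, hu s hs] at h2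
    exact h2
  have h1 := key t ht
  have h2 := key 0 le_rfl
  linarith

/-- The flow on an edge between two nodes moves monotonically against an increasing primitive of
the output error of one end, as long as the other end is at rest. -/
theorem edge_flow_le (hreg : S.Regular) (hout : S.GoodOutputs) (hy : SolvesODE S.field y)
    {i j : V} {k : ι} {H : ℝ → ℝ}
    (hH : ∀ t, 0 ≤ t → HasDerivWithinAt H ((mapVec S.h (y t).1 - S.ybar) j) (Ici 0) t)
    (hk : S.B i k = 1 ∨ S.B i k = -1)
    (hkj : ∀ t, 0 ≤ t → S.B.transpose.mulVec (mapVec S.h (y t).1 - S.ybar) k =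
      -S.B i k * (mapVec S.h (y t).1 - S.ybar) j) {s t : ℝ} (hs : 0 ≤ s) (ht : 0 ≤ t)
    (hst : H s < H t) :
    S.B i k * S.f k ((y t).2.1 k) < S.B i k * S.f k ((y s).2.1 k) := by
  have h1 : ∀ t, 0 ≤ t →
      HasDerivWithinAt (fun t => S.Tmu k * (y t).2.1 k + S.B i k * H t) 0 (Ici 0) t := by
    intro t ht
    have h2 : HasDerivWithinAt (fun s => (y s).2.1 k)
      (S.B.transpose.mulVec (mapVec S.h (y t).1 - S.ybar) k / S.Tmu k) (Ici 0) t :=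
      hasDerivWithinAt_mu hy k ht
    refine ((h2.const_mul (S.Tmu k)).add ((hH t ht).const_mul (S.B i k))).congr_deriv ?_
    rw [hkj t ht, mul_div_cancel₀ _ (hreg.Tmu_pos k).ne']
    ring
  have h3 := (eq_initial_of_hasDerivWithinAt_zero h1 hs).trans
    (eq_initial_of_hasDerivWithinAt_zero h1 ht).symm
  have hT := hreg.Tmu_pos k
  rcases hk with hk | hk <;> rw [hk] at h3 ⊢
  · have := hout.f_strictMono k (show (y t).2.1 k < (y s).2.1 k by
      by_contra! hc
      have := mul_le_mul_of_nonneg_left hc hT.le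
      linarith)
    linarith
  · have := hout.f_strictMono k (show (y s).2.1 k < (y t).2.1 k by
      by_contra! hc
      have := mul_le_mul_of_nonneg_left hc hT.le
      linarith)
    linarith

theorem forcing_step (hreg : S.Regular) (hout : S.GoodOutputs) (hy : SolvesODE S.field y)
    {xbar : V → ℝ} (hxbar : ∀ i, S.h i (xbar i) = S.ybar i)
    (hPsi : ∀ t, 0 ≤ t → S.Psi (y t).1 = S.Psi xbar)
    (hu : ∀ t, 0 ≤ t → mapVec S.g (y t).2.2.1 = mapVec S.g (y 0).2.2.1) {i j : V}
    (hi : ∀ t, 0 ≤ t → (y t).1 i = xbar i) (hij : S.net.graph.Adj i j)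
    (hne : ∀ l, S.net.graph.Adj i l → l ≠ j → ∀ t, 0 ≤ t → (y t).1 l = xbar l) :
    ∀ t, 0 ≤ t → (y t).1 j = xbar j := by
  have herr : ∀ {l : V}, (∀ t, 0 ≤ t → (y t).1 l = xbar l) → ∀ t, 0 ≤ t →
      (mapVec S.h (y t).1 - S.ybar) l = 0 := by
    intro l hl t ht
    rw [Pi.sub_apply, mapVec, hl t ht, hxbar, sub_self]
  obtain ⟨k₀, hk₀, hk₀j⟩ := S.net.exists_edge_of_adj hij
  change S.B i k₀ = 1 ∨ S.B i k₀ = -1 at hk₀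
  have hk₀j' : ∀ t, 0 ≤ t → S.B.transpose.mulVec (mapVec S.h (y t).1 - S.ybar) k₀ =
      -S.B i k₀ * (mapVec S.h (y t).1 - S.ybar) j := fun t ht => hk₀j _ (herr hi t ht)
  -- The state of one edge from `i` to `j`, rescaled and signed, is itself a primitive of the output
  -- error at `j`.
  let H : ℝ → ℝ := fun t => -S.B i k₀ * (S.Tmu k₀ * (y t).2.1 k₀)
  have hH : ∀ t, 0 ≤ t → HasDerivWithinAt H ((mapVec S.h (y t).1 - S.ybar) j) (Ici 0) t := by
    intro t ht
    have h2 : HasDerivWithinAt (fun s => (y s).2.1 k₀)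
      (S.B.transpose.mulVec (mapVec S.h (y t).1 - S.ybar) k₀ / S.Tmu k₀) (Ici 0) t :=
      hasDerivWithinAt_mu hy k₀ ht
    refine ((h2.const_mul (S.Tmu k₀)).const_mul (-S.B i k₀)).congr_deriv ?_
    rw [mul_div_cancel₀ _ (hreg.Tmu_pos k₀).ne', hk₀j' t ht]
    rcases hk₀ with h | h <;> rw [h] <;> ring
  -- When `H` increases, outflows from `i` along edges to `j` drop, while edges to other neighbours
  -- have both ends at rest and keep their flow. The net outflow would drop strictly.
  have hle : ∀ s t, 0 ≤ s → 0 ≤ t → H s < H t → ∀ k,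
      S.B i k * S.f k ((y t).2.1 k) ≤ S.B i k * S.f k ((y s).2.1 k) := by
    intro s t hs ht hst k
    by_cases hk : S.B i k = 0
    · rw [hk, zero_mul, zero_mul]
    obtain ⟨l, hil, hk1, hkl⟩ := S.net.exists_adj_of_incidence_ne_zero hk
    by_cases hlj : l = j
    · subst hlj
      exact (edge_flow_le hreg hout hy hH hk1 (fun t ht => hkl _ (herr hi t ht)) hs ht hst).le
    · have h1 : ∀ t, 0 ≤ t → HasDerivWithinAt (fun s => (y s).2.1 k) 0 (Ici 0) t := by
        intro t ht
        refine (hasDerivWithinAt_mu hy k ht).congr_deriv ?_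
        change S.B.transpose.mulVec (mapVec S.h (y t).1 - S.ybar) k / S.Tmu k = 0
        rw [show S.B.transpose.mulVec (mapVec S.h (y t).1 - S.ybar) k = _ from
          hkl _ (herr hi t ht), herr (hne l hil hlj) t ht, mul_zero, zero_div]
      have h2 : (y s).2.1 k = (y t).2.1 k := (eq_initial_of_hasDerivWithinAt_zero h1 hs).trans
        (eq_initial_of_hasDerivWithinAt_zero h1 ht).symm
      rw [h2]
  have hnot : ∀ s t, 0 ≤ s → 0 ≤ t → ¬ H s < H t := by
    intro s t hs ht hst
    have h1 : S.B.mulVec (mapVec S.f (y t).2.1) i < S.B.mulVec (mapVec S.f (y s).2.1) i :=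
      Finset.sum_lt_sum (fun k _ => hle s t hs ht hst k)
        ⟨k₀, Finset.mem_univ _, edge_flow_le hreg hout hy hH hk₀ hk₀j' hs ht hst⟩
    rw [net_outflow_const hreg hy hPsi hu hi ht, net_outflow_const hreg hy hPsi hu hi hs] at h1
    exact lt_irrefl _ h1
  intro t ht
  have h1 := eq_zero_of_hasDerivWithinAt_of_const ht (hH t ht) fun s hs =>
    le_antisymm (not_lt.1 (hnot 0 s le_rfl hs)) (not_lt.1 (hnot s 0 hs le_rfl))
  rw [Pi.sub_apply, mapVec, ← hxbar, sub_eq_zero] at h1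
  exact (hreg.h_strictMono j).injective h1

/-- A solution along which no storage is dissipated starts at a steady state. -/
theorem isEquilibrium_of_storageDeriv_eq_zero (hreg : S.Regular) (hcom : S.GoodCommunication)
    (hout : S.GoodOutputs) {xbar : V → ℝ} (hxbar : ∀ i, S.h i (xbar i) = S.ybar i)
    (hzf : IsZeroForcingSet S.net.graph ((S.Ve : Set V) ∪ S.Vs xbar)) {p : S.State}
    (h1 : p.1 = xbar) (h2 : mapVec S.g p.2.2.1 = S.uHat xbar) (h3 : p.2.2.2 = S.uHat xbar)
    (h4 : S.Feasible xbar (S.uHat xbar) (mapVec S.f p.2.1)) (hy : SolvesODE S.field y)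
    (hdiss : ∀ t, 0 ≤ t → S.storageDeriv p (y t) (S.field (y t)) = 0) :
    S.IsEquilibrium (y 0) := by
  have hz := fun t ht => storageDeriv_eq_zero hreg hcom hxbar h1 h2 h3 h4 (hdiss t ht)
  have hPsi : ∀ t, 0 ≤ t → S.Psi (y t).1 = S.Psi xbar := fun t ht => (hz t ht).1
  have hfph : ∀ t, 0 ≤ t → (S.field (y t)).2.2.2 = 0 := by
    intro t ht
    change (fun i => (mapVec S.g (y t).2.2.1 - (y t).2.2.2
      - S.Q.mulVec (S.Lcom.mulVec (S.Q.mulVec (y t).2.2.2 + S.r))) i / S.Tph i) = 0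
    rw [(hz t ht).2.2.1, (hz t ht).2.2.2, Matrix.mulVec_zero]
    funext i
    simp
  have hph : ∀ t, 0 ≤ t → (y t).2.2.2 = (y 0).2.2.2 := by
    intro t ht
    funext i
    refine eq_initial_of_hasDerivWithinAt_zero (u := fun s => (y s).2.2.2 i) (fun s hs => ?_) ht
    exact (hasDerivWithinAt_ph hy i hs).congr_deriv (congrFun (hfph s hs) i)
  have hu : ∀ t, 0 ≤ t → mapVec S.g (y t).2.2.1 = mapVec S.g (y 0).2.2.1 := fun t ht => by
    rw [(hz t ht).2.2.1, (hz 0 le_rfl).2.2.1, hph t ht]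
  -- `g(θ) = φ` is constant and `g` is injective, so `θ` rests; its equation then leaves only the
  -- output error on the controlled nodes.
  have hfth : ∀ t, 0 ≤ t → (S.field (y t)).2.2.1 = 0 := fun t ht => funext fun i =>
    eq_zero_of_hasDerivWithinAt_of_const ht (hasDerivWithinAt_th hy i ht) fun s hs =>
      (hout.g_strictMono i).injective (congrFun (hu s hs) i)
  have hVe : ∀ i ∈ S.Ve, ∀ t, 0 ≤ t → (y t).1 i = xbar i := by
    intro i hi t ht
    have e1 : (-S.E.transpose.mulVec (mapVec S.h (y t).1 - S.ybar)
      - (mapVec S.g (y t).2.2.1 - (y t).2.2.2)) ⟨i, hi⟩ / S.Tth ⟨i, hi⟩ = 0 :=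
      congrFun (hfth t ht) ⟨i, hi⟩
    rw [div_eq_zero_iff, or_iff_left (hreg.Tth_pos _).ne', (hz t ht).2.2.1, sub_self, sub_zero,
      Pi.neg_apply, neg_eq_zero, E, transpose_selection_mulVec_apply, Pi.sub_apply, mapVec,
      ← hxbar, sub_eq_zero] at e1
    exact (hreg.h_strictMono i).injective e1
  have hx : ∀ i t, 0 ≤ t → (y t).1 i = xbar i := by
    intro i
    induction hzf i with
    | init i hi =>
      rcases hi with hi | hi
      · exact hVe i hi
      · exact fun t ht => (hz t ht).2.1 i hi
    | step i j _ hij _ ih1 ih2 => exact forcing_step hreg hout hy hxbar hPsi hu ih1 hij ih2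
  refine Prod.ext ?_ (Prod.ext ?_ (Prod.ext (hfth 0 le_rfl) (hfph 0 le_rfl)))
  · funext i
    exact eq_zero_of_hasDerivWithinAt_of_const le_rfl (hasDerivWithinAt_x hy i le_rfl) (hx i)
  · have e1 : mapVec S.h (y 0).1 - S.ybar = 0 := by
      funext i
      rw [Pi.sub_apply, mapVec, hx i 0 le_rfl, hxbar, sub_self, Pi.zero_apply]
    change (fun k => S.B.transpose.mulVec (mapVec S.h (y 0).1 - S.ybar) k / S.Tmu k) = 0
    rw [e1, Matrix.mulVec_zero]
    funext k
    simp

end Forcing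

theorem continuous_mapVec {α : Type*} {F : α → ℝ → ℝ} (hF : ∀ i, Continuous (F i)) :
    Continuous (mapVec F) :=
  continuous_pi fun i => (hF i).comp (continuous_apply i)

theorem tendsto_norm_mapVec_sub {α : Type*} [Fintype α] {F : α → ℝ → ℝ}
    (hF : ∀ i, Continuous (F i)) {v : ℝ → α → ℝ} {a b : α → ℝ} (hv : Tendsto v atTop (𝓝 a))
    (hab : mapVec F a = b) : Tendsto (fun t => ‖mapVec F (v t) - b‖) atTop (𝓝 0) := by
  rw [← hab, ← tendsto_iff_norm_sub_tendsto_zero]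
  exact ((continuous_mapVec hF).tendsto a).comp hv

end FlowSystem

/-! ### Assembly of the corollary -/

theorem corollary1 {V ι κ : Type*} [Fintype V] [Fintype ι] [Fintype κ] [DecidableEq V]
    (S : FlowSystem V ι κ) (hreg : S.Regular)
    (hconn : S.net.graph.Connected)
    (hinput : S.Ve.Nonempty)
    (xbar : V → ℝ) (hxbar : ∀ i, S.h i (xbar i) = S.ybar i)
    (hcom : S.GoodCommunication)
    (hout : S.GoodOutputs)
    (hatt : S.Attainable xbar)
    (hzf : IsZeroForcingSet S.net.graph ((S.Ve : Set V) ∪ S.Vs xbar)) :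
    -- the vector `û` is the unique optimal input
    (∀ u, S.IsOptimalInput xbar u ↔ u = S.uHat xbar) ∧
    -- there is a steady state, and a solution from every initial condition
    (∃ zbar, S.IsEquilibrium zbar) ∧
    (∀ z₀ : S.State, ∃ z, S.IsSolution z ∧ z 0 = z₀) ∧
    -- for every steady state `(x̄, μ̄, θ̄, φ̄)`:
    ∀ zbar, S.IsEquilibrium zbar →
      zbar.1 = xbar ∧
      -- on `Υ₄` everything is constant, `h(x) = ȳ` and `u = g(θ) = û`
      (∀ z ∈ S.Upsilon zbar, S.IsEquilibrium z ∧
        mapVec S.h z.1 = S.ybar ∧ mapVec S.g z.2.2.1 = S.uHat xbar) ∧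
      ∀ z, S.IsSolution z →
        -- convergence to a point of `Υ₄`
        (∃ zlim ∈ S.Upsilon zbar, Tendsto z atTop (𝓝 zlim)) ∧
        -- output regulation and optimal inputs
        Tendsto (fun t => ‖mapVec S.h (z t).1 - S.ybar‖) atTop (𝓝 0) ∧
        Tendsto (fun t => ‖mapVec S.g (z t).2.2.1 - S.uHat xbar‖) atTop (𝓝 0) ∧
        -- flow and input constraints at all times
        ∀ t, 0 ≤ t →
          (∀ k, S.lamMin k < (S.f k ((z t).2.1 k) : EReal) ∧
            (S.f k ((z t).2.1 k) : EReal) < S.lamMax k) ∧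
          (∀ i, S.uMin i < (S.g i ((z t).2.2.1 i) : EReal) ∧
            (S.g i ((z t).2.2.1 i) : EReal) < S.uMax i) := by
  have hiff := fun z => FlowSystem.isEquilibrium_iff_eq hreg hconn hinput hxbar hcom z
  obtain ⟨lam, hlam, hlamf⟩ := FlowSystem.exists_feasible_uHat hreg hconn hinput hatt
  choose mu hmu using hlamf
  choose th hth using hatt.2
  have hmu' : mapVec S.f mu = lam := funext hmu
  have hth' : mapVec S.g th = S.uHat xbar := funext hth
  have hf0 : S.Feasible xbar (S.uHat xbar) (mapVec S.f mu) := hmu' ▸ hlam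
  have hF := FlowSystem.contDiff_field hreg hout
  have hlyap : ∀ p : S.State, S.IsEquilibrium p →
      IsLyapunov S.field (S.storage p) (S.storageDeriv p) := by
    intro p hp
    obtain ⟨h1, h2, h3, h4⟩ := (hiff p).1 hp
    exact FlowSystem.isLyapunov_storage hreg hout hcom hxbar h1 h2 h3 h4
  have heq0 : S.IsEquilibrium (xbar, mu, th, S.uHat xbar) :=
    (hiff _).2 ⟨rfl, hth', rfl, hf0⟩
  refine ⟨FlowSystem.isOptimalInput_iff hreg hinput ⟨lam, hlam⟩, ⟨_, heq0⟩,
    (hlyap _ heq0).exists_solvesODE hF, fun zbar hzbar => ?_⟩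
  obtain ⟨h1, h2, h3, h4⟩ := (hiff zbar).1 hzbar
  refine ⟨h1, ?_, fun z hz => ?_⟩
  · rintro w ⟨hw1, hw2, hw3, hw4⟩
    rw [Matrix.mulVec_sub, sub_eq_zero] at hw1
    refine ⟨(hiff w).2 ⟨hw2.trans h1, hw3 ▸ h2, hw4.trans h3, ?_⟩, ?_, hw3 ▸ h2⟩
    · rw [FlowSystem.Feasible, hw1]
      exact h4
    · rw [hw2, h1]
      exact funext hxbar
  obtain ⟨y, hy, hclus, hdiss⟩ := (hlyap zbar hzbar).exists_limit_solution hF hz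
  have hyeq : S.IsEquilibrium (y 0) :=
    FlowSystem.isEquilibrium_of_storageDeriv_eq_zero hreg hcom hout hxbar hzf h1 h2 h3 h4 hy hdiss
  -- The base point of the storage function changes here from `zbar` to the cluster point, which is
  -- what yields convergence to a single point.
  have hlim : Tendsto z atTop (𝓝 (y 0)) := (hlyap _ hyeq).tendsto_of_mapClusterPt
    (fun _ => FlowSystem.eq_of_storage_le hreg hout) hz hclus
  obtain ⟨y1, y2, y3, y4⟩ := (hiff _).1 hyeq
  refine ⟨⟨y 0, ⟨?_, y1.trans h1.symm, funext fun i => ?_, y3.trans h3.symm⟩, hlim⟩, ?_, ?_,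
    fun t _ => ⟨fun k => ?_, fun i => ?_⟩⟩
  · have e1 := y4.symm.trans h4
    rw [Matrix.mulVec_sub, sub_eq_zero]
    simpa using e1
  · exact (hout.g_strictMono i).injective (congrFun (y2.trans h2.symm) i)
  · exact FlowSystem.tendsto_norm_mapVec_sub (fun i => (hreg.h_contDiff i).continuous)
      ((continuous_fst.tendsto _).comp hlim) (y1.symm ▸ funext hxbar)
  · exact FlowSystem.tendsto_norm_mapVec_sub (fun i => (hout.g_contDiff i).continuous)
      (((continuous_fst.comp (continuous_snd.comp continuous_snd)).tendsto _).comp hlim) y2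
  · have := mem_range_self (f := S.f k) ((z t).2.1 k)
    rwa [hout.f_range] at this
  · have := mem_range_self (f := S.g i) ((z t).2.2.1 i)
    rwa [hout.g_range] at this
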